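/- Let $1<m<2$, let $c>0$, and let $G_m(x)=c\,|x|^{m-2}$ for $x\in\mathbb{R}^2\setminus\{0\}$ (for the appropriate constant $c=c(m)$ this is the Green function of the fractional Laplacian $(-\Delta)^{m/2}$ on $\mathbb{R}^2$). Write $\nabla^\perp=(-\partial_{x_2},\partial_{x_1})$. Let $N\in\mathbb{N}$ and let $\gamma_1,\dots,\gamma_N\in\mathbb{R}$ be such that $$\sum_{j\in J}\gamma_j\neq 0\qquad\text{for every non-empty } J\subseteq\{1,\dots,N\}.$$ Then for Lebesgue-almost every $(x_1,\dots,x_N)\in(\mathbb{R}^2)^N$ the initial value problem $$\dot X_j(t)=\sum_{k\neq j}\gamma_k\,\nabla^\perp G_m\bigl(X_j(t)-X_k(t)\bigr),\qquad X_j(0)=x_j,\qquad j=1,\dots,N,$$ has a global smooth solution without collisions: there are $C^\infty$ functions $X_1,\dots,X_N:[0,\infty)\to\mathbb{R}^2$ that satisfy the system for all $t\ge 0$ (with one-sided derivatives at $t=0$) and $X_j(t)\neq X_k(t)$ for all $t\ge0$ and all $j\ne k$. -/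

import Mathlib

open scoped ContDiff

noncomputable section

namespace PointVortex

/-- The Euclidean plane. -/
abbrev Plane : Type := EuclideanSpace ℝ (Fin 2)

/-- The kernel `G_m(x) = c |x|^(m-2)`, `x ≠ 0`. For `1 < m < 2` and the appropriate positive
constant `c = c(m)` this is the Green function of `(-Δ)^(m/2)` on the plane. The (junk) value
at `x = 0` is never relevant: only collisionless configurations are considered. -/
def green (m c : ℝ) (x : Plane) : ℝ := c * ‖x‖ ^ (m - 2)

/-- The rotated gradient `∇^⊥ f = (-∂₂ f, ∂₁ f)`. -/
def perpGrad (f : Plane → ℝ) (x : Plane) : Plane :=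
  !₂[-(fderiv ℝ f x (EuclideanSpace.single 1 1)), fderiv ℝ f x (EuclideanSpace.single 0 1)]

/-- `X` is a global smooth solution, without collisions, of the point vortex system
`X_j' = ∑_{k ≠ j} γ_k ∇^⊥ G (X_j - X_k)`, `X_j(0) = x_j`, on the time interval `[0, ∞)`.
Derivatives at `t = 0` are one-sided. -/
structure IsGlobalSmoothSolution {N : ℕ} (G : Plane → ℝ) (γ : Fin N → ℝ)
    (x : Fin N → Plane) (X : Fin N → ℝ → Plane) : Prop where
  initial : ∀ j, X j 0 = x j
  noncollision : ∀ t, 0 ≤ t → ∀ j k, j ≠ k → X j t ≠ X k t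
  smooth : ∀ j, ContDiffOn ℝ ∞ (X j) (Set.Ici 0)
  motion : ∀ j, ∀ t, 0 ≤ t →
    HasDerivWithinAt (X j)
      (∑ k ∈ Finset.univ.erase j, γ k • perpGrad G (X j t - X k t)) (Set.Ici 0) t

end PointVortex

end

/-!
Regularize the kernel at scale `ε`. The regularized flow preserves volume. Vortices move a distance
bounded independently of `ε`: a cluster of small diameter follows its centre of vorticity, which
exists because no partial sum of the circulations vanishes, and a cluster of large diameter splits
into parts that hardly interact. Let `q = 3 - m` be the order of the singularity of the kernel, and
consider the energy `∑ |x_i - x_j|^(1 - q)`. Two vortices induce on each other velocities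
orthogonal to their separation, so only triples of distinct vortices contribute to the rate of
change of the energy, and the resulting majorant is locally integrable since `1 < q < 2`. By
volume preservation the supremum of the energy along the flow then has a bounded integral, uniformly
in `ε`, whereas a collision at scale `ε` requires energy at least of order `ε^(1 - q)`. Hence almost
no initial configuration collides before a given time.
-/

noncomputable section

open Set Filter Topology MeasureTheory
open scoped NNReal ENNReal

namespace PointVortex

section Displacement

/-- The velocity induced at the `j`-th point of the configuration `x` by the other points of the
cluster `J`. The velocity field of the whole system is the case `J = univ`. -/
def vortexField {ι E : Type*} [DecidableEq ι] [AddCommGroup E] [Module ℝ E] (γ : ι → ℝ)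
    (K : E → E) (J : Finset ι) (x : ι → E) (j : ι) : E :=
  ∑ k ∈ J.erase j, γ k • K (x j - x k)

/-- The total absolute circulation `∑ |γ j|`. -/
def absCirculation {ι : Type*} [Fintype ι] (γ : ι → ℝ) : ℝ :=
  ∑ j, |γ j|

section Field

variable {ι E : Type*} [DecidableEq ι] [AddCommGroup E] [Module ℝ E] {γ : ι → ℝ} {K : E → E}

lemma sum_smul_vortexField_eq_zero (hK : K.Odd) (J : Finset ι) (x : ι → E) :
    ∑ j ∈ J, γ j • vortexField γ K J x j = 0 := by
  have : IsAddTorsionFree E := .of_isTorsionFree ℝ E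
  have hfull : ∀ j ∈ J, γ j • vortexField γ K J x j =
      ∑ k ∈ J, (γ j * γ k) • K (x j - x k) := by
    intro j hj
    rw [vortexField, ← Finset.add_sum_erase J _ hj, Finset.smul_sum]
    simp [hK.map_zero, mul_smul]
  rw [Finset.sum_congr rfl hfull]
  refine self_eq_neg.1 ?_
  conv_rhs => rw [Finset.sum_comm]
  simp only [← Finset.sum_neg_distrib]
  refine Finset.sum_congr rfl fun j _ => Finset.sum_congr rfl fun k _ => ?_
  rw [← neg_sub (x j) (x k), hK, smul_neg, neg_neg, mul_comm]

lemma vortexField_eq_add_sum_sdiff {I J : Finset ι} (hIJ : I ⊆ J) {k : ι} (hk : k ∈ I)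
    (x : ι → E) :
    vortexField γ K J x k =
      vortexField γ K I x k + ∑ l ∈ J \ I, γ l • K (x k - x l) := by
  have hdisj : Disjoint (I.erase k) (J \ I) :=
    Finset.disjoint_sdiff.mono_left (Finset.erase_subset _ _)
  have hunion : J.erase k = I.erase k ∪ J \ I := by grind
  rw [vortexField, hunion, Finset.sum_union hdisj, vortexField]

end Field

/-- By pigeonhole, one of the `#J + 1` annuli of width `r` around `x i` contains no point of the
family; the points inside it and the points outside it form the two parts. -/
lemma exists_separated_partition {ι M : Type*} [DecidableEq ι] [PseudoMetricSpace M]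
    (J : Finset ι) (x : ι → M) {r : ℝ} (hr : 0 < r) {i j : ι} (hi : i ∈ J)
    (hj : j ∈ J) (hij : (J.card + 1) * r ≤ dist (x i) (x j)) :
    ∃ I ⊂ J, I.Nonempty ∧ ∀ k ∈ I, ∀ l ∈ J \ I, r ≤ dist (x k) (x l) := by
  set annulus : ι → ℕ := fun k => ⌊dist (x i) (x k) / r⌋₊ with hannulus
  obtain ⟨l, hl, hlJ⟩ : ∃ l ∈ Finset.range (J.card + 1), l ∉ J.image annulus :=
    Finset.exists_mem_notMem_of_card_lt_card <| by
      simpa [Nat.lt_succ_iff] using Finset.card_image_le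
  have hne : ∀ k ∈ J, annulus k ≠ l := fun k hk h => hlJ (h ▸ Finset.mem_image_of_mem _ hk)
  have hi0 : annulus i = 0 := by simp [hannulus]
  have hl0 : 0 < l := Nat.pos_of_ne_zero fun h => hne i hi (hi0.trans h.symm)
  have hlj : l ≤ annulus j := by
    refine (Finset.mem_range.1 hl).le.trans (Nat.le_floor ?_)
    rw [le_div_iff₀ hr]
    exact_mod_cast hij
  refine ⟨J.filter (annulus · < l), Finset.filter_ssubset.2 ⟨j, hj, hlj.not_gt⟩,
    ⟨i, by simp [hi, hi0, hl0]⟩, fun k hk k' hk' => ?_⟩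
  simp only [Finset.mem_sdiff, Finset.mem_filter, not_and, not_lt] at hk hk'
  have hinside : dist (x i) (x k) < l * r := by
    rw [← div_lt_iff₀ hr]
    exact (Nat.floor_lt (by positivity)).1 hk.2
  have houtside : (l + 1) * r ≤ dist (x i) (x k') := by
    rw [← le_div_iff₀ hr]
    exact_mod_cast (Nat.le_floor_iff (by positivity)).1
      ((hk'.2 hk'.1).lt_of_ne (hne k' hk'.1).symm)
  linarith [dist_triangle (x i) (x k) (x k')]

lemma one_le_of_bootstrap {φ : ℝ → ℝ} {τ₀ τ₁ : ℝ} (hφ : ContinuousOn φ (uIcc τ₀ τ₁))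
    (h₀ : 2 ≤ φ τ₀)
    (hstep : ∀ σ ∈ uIcc τ₀ τ₁, (∀ τ ∈ uIcc τ₀ σ, 1 ≤ φ τ) → 2 ≤ φ σ) : 1 ≤ φ τ₁ := by
  by_contra! hlt
  have hcross : ∀ τ ∈ uIcc τ₀ τ₁, φ τ < 1 → ∃ σ ∈ uIcc τ₀ τ, φ σ = 3 / 2 := fun τ hτ hlt =>
    intermediate_value_uIcc (hφ.mono (uIcc_subset_uIcc_left hτ))
      (mem_uIcc.2 (Or.inr ⟨by linarith, by linarith⟩))
  have hcomp : IsCompact (uIcc τ₀ τ₁ ∩ φ ⁻¹' {3 / 2}) :=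
    isCompact_uIcc.of_isClosed_subset
      (hφ.preimage_isClosed_of_isClosed isCompact_uIcc.isClosed isClosed_singleton)
      inter_subset_left
  obtain ⟨σ, ⟨hσ, hφσ⟩, hmin⟩ := hcomp.exists_isMinOn
    (let ⟨σ, hσ, hφσ⟩ := hcross τ₁ right_mem_uIcc hlt; ⟨σ, hσ, hφσ⟩)
    (f := fun τ => |τ - τ₀|) (by fun_prop)
  have hφσ : φ σ = 3 / 2 := hφσ
  refine absurd (hstep σ hσ fun τ hτ => ?_) (by rw [hφσ]; norm_num)
  by_contra! hτlt
  have hτ₁ := uIcc_subset_uIcc_left hσ hτ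
  obtain ⟨ρ, hρ, hφρ⟩ := hcross τ hτ₁ hτlt
  have hle : |σ - τ₀| ≤ |τ - τ₀| :=
    (hmin ⟨uIcc_subset_uIcc_left hτ₁ hρ, hφρ⟩).trans (abs_sub_left_of_mem_uIcc hρ)
  have hτσ : τ = σ := by
    rcases mem_uIcc.1 hτ with h | h <;> cases abs_cases (σ - τ₀) <;> cases abs_cases (τ - τ₀) <;>
      linarith
  rw [hτσ, hφσ] at hτlt
  norm_num at hτlt

lemma one_le_dist_of_bootstrap {ι M : Type*} [PseudoMetricSpace M] {X : ℝ → ι → M}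
    {I I' : Finset ι} {S : Set ℝ} (hS : S.OrdConnected)
    (hI : ∀ k ∈ I, ContinuousOn (fun τ => X τ k) S)
    (hI' : ∀ l ∈ I', ContinuousOn (fun τ => X τ l) S) {D : ℝ} (hD : 0 ≤ D) {τ₀ : ℝ}
    (hτ₀ : τ₀ ∈ S)
    (hsep : ∀ k ∈ I, ∀ l ∈ I', 2 + 2 * D ≤ dist (X τ₀ k) (X τ₀ l))
    (hstep : ∀ σ ∈ S, (∀ τ ∈ uIcc τ₀ σ, ∀ k ∈ I, ∀ l ∈ I', 1 ≤ dist (X τ k) (X τ l)) →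
      (∀ k ∈ I, dist (X τ₀ k) (X σ k) ≤ D) ∧ ∀ l ∈ I', dist (X τ₀ l) (X σ l) ≤ D) :
    ∀ τ ∈ S, ∀ k ∈ I, ∀ l ∈ I', 1 ≤ dist (X τ k) (X τ l) := by
  intro τ₁ hτ₁ k₁ hk₁ l₁ hl₁
  have hsub : uIcc τ₀ τ₁ ⊆ S := hS.uIcc_subset hτ₀ hτ₁
  have hne : (I ×ˢ I').Nonempty := ⟨(k₁, l₁), Finset.mk_mem_product hk₁ hl₁⟩
  set φ : ℝ → ℝ := fun τ => (I ×ˢ I').inf' hne fun p => dist (X τ p.1) (X τ p.2) with hφ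
  have hφle : ∀ c τ, c ≤ φ τ ↔ ∀ k ∈ I, ∀ l ∈ I', c ≤ dist (X τ k) (X τ l) := by
    simp only [hφ, Finset.le_inf'_iff, Finset.mem_product, Prod.forall, and_imp]
    grind
  have hφc : ContinuousOn φ (uIcc τ₀ τ₁) := by
    refine ContinuousOn.finset_inf'_apply hne fun p hp => ?_
    rw [Finset.mem_product] at hp
    exact continuous_dist.comp_continuousOn
      (((hI p.1 hp.1).mono hsub).prodMk ((hI' p.2 hp.2).mono hsub))
  have h₀ : 2 ≤ φ τ₀ := (hφle 2 τ₀).2 fun k hk l hl => by linarith [hsep k hk l hl]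
  refine (hφle 1 τ₁).1 (one_le_of_bootstrap hφc h₀ fun σ hσ hall => ?_) k₁ hk₁ l₁ hl₁
  obtain ⟨hdI, hdI'⟩ := hstep σ (hsub hσ) fun τ hτ => (hφle 1 τ).1 (hall τ hτ)
  refine (hφle 2 σ).2 fun k hk l hl => ?_
  have htri := dist_triangle4 (X τ₀ k) (X σ k) (X σ l) (X τ₀ l)
  rw [dist_comm (X σ l)] at htri
  linarith [hsep k hk l hl, hdI k hk, hdI' l hl]

/-- The points of the cluster `J` move, during the time set `S`, under their mutual interaction and
an external velocity field of size at most `B`. -/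
def IsClusterMotion {ι E : Type*} [DecidableEq ι] [NormedAddCommGroup E] [NormedSpace ℝ E]
    (γ : ι → ℝ) (K : E → E) (J : Finset ι) (B : ℝ) (S : Set ℝ) (X : ℝ → ι → E) : Prop :=
  ∀ j ∈ J, ∀ τ ∈ S, ∃ v, HasDerivWithinAt (fun σ => X σ j) v S τ ∧
    ‖v - vortexField γ K J (X τ) j‖ ≤ B

variable {ι E : Type*} [Fintype ι] [NormedAddCommGroup E] [NormedSpace ℝ E] {γ : ι → ℝ}

lemma absCirculation_nonneg : 0 ≤ absCirculation γ :=
  Finset.sum_nonneg fun _ _ => abs_nonneg _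

lemma norm_sum_smul_le_absCirculation_mul {J : Finset ι} {v : ι → E} {b : ℝ} (hb : 0 ≤ b)
    (hv : ∀ j ∈ J, ‖v j‖ ≤ b) : ‖∑ j ∈ J, γ j • v j‖ ≤ absCirculation γ * b :=
  calc ‖∑ j ∈ J, γ j • v j‖ ≤ ∑ j ∈ J, |γ j| * b := norm_sum_le_of_le _ fun j hj => by
        rw [norm_smul, Real.norm_eq_abs]
        exact mul_le_mul_of_nonneg_left (hv j hj) (abs_nonneg _)
    _ = (∑ j ∈ J, |γ j|) * b := by rw [Finset.sum_mul]
    _ ≤ absCirculation γ * b := by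
        gcongr
        exact Finset.sum_le_univ_sum_of_nonneg fun _ => abs_nonneg _

/-- Bound for the displacement, during a time `T`, of the points of a cluster of at most `n` points
in an external field of size `B`, if the interaction is bounded by `b` at distances at least `1`. -/
def displacementBound (γ : ι → ℝ) (b T : ℝ) : ℕ → ℝ → ℝ
  | 0, _ => 0
  | n + 1, B =>
    let D := displacementBound γ b T n (B + absCirculation γ * b)
    D + (absCirculation γ * B * T + 2 * absCirculation γ * ((n + 2) * (2 + 2 * D))) *
      ∑ J : Finset ι, |∑ j ∈ J, γ j|⁻¹

lemma displacementBound_nonneg {b T : ℝ} (hb : 0 ≤ b) (hT : 0 ≤ T) (n : ℕ) {B : ℝ} (hB : 0 ≤ B) :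
    0 ≤ displacementBound γ b T n B := by
  have hΓ := absCirculation_nonneg (γ := γ)
  induction n generalizing B with
  | zero => exact le_rfl
  | succ n ih =>
    have := ih (B := B + absCirculation γ * b) (by positivity)
    rw [displacementBound]
    positivity

namespace IsClusterMotion

variable [DecidableEq ι] {K : E → E} {J : Finset ι} {B : ℝ} {S : Set ℝ} {X : ℝ → ι → E}

omit [Fintype ι] in
lemma mono (hX : IsClusterMotion γ K J B S X) {S' : Set ℝ} (hS' : S' ⊆ S) :
    IsClusterMotion γ K J B S' X := fun j hj τ hτ =>
  let ⟨v, hv, hvB⟩ := hX j hj τ (hS' hτ)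
  ⟨v, hv.mono hS', hvB⟩

omit [Fintype ι] in
lemma continuousOn (hX : IsClusterMotion γ K J B S X) {j : ι} (hj : j ∈ J) :
    ContinuousOn (fun τ => X τ j) S := fun τ hτ =>
  let ⟨_, hv, _⟩ := hX j hj τ hτ
  hv.continuousWithinAt

lemma subcluster {b : ℝ} (hb : 0 ≤ b) (hK : ∀ u, 1 ≤ ‖u‖ → ‖K u‖ ≤ b)
    (hX : IsClusterMotion γ K J B S X) {I : Finset ι} (hIJ : I ⊆ J)
    (hfar : ∀ τ ∈ S, ∀ k ∈ I, ∀ l ∈ J \ I, 1 ≤ dist (X τ k) (X τ l)) :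
    IsClusterMotion γ K I (B + absCirculation γ * b) S X := by
  intro k hk τ hτ
  obtain ⟨v, hv, hvB⟩ := hX k (hIJ hk) τ hτ
  refine ⟨v, hv, ?_⟩
  have hext : ‖∑ l ∈ J \ I, γ l • K (X τ k - X τ l)‖ ≤ absCirculation γ * b :=
    norm_sum_smul_le_absCirculation_mul hb fun l hl =>
      hK _ (by simpa only [dist_eq_norm] using hfar τ hτ k hk l hl)
  rw [vortexField_eq_add_sum_sdiff hIJ hk, ← sub_sub] at hvB
  exact (norm_le_norm_sub_add _ _).trans (add_le_add hvB hext)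

/-- Since the mutual interactions cancel, the external field alone moves the centre of vorticity. -/
lemma norm_sum_smul_sub_le (hK : K.Odd) (hX : IsClusterMotion γ K J B S X) (hB : 0 ≤ B)
    (hS : Convex ℝ S) {T : ℝ} {τ τ' : ℝ} (hτ : τ ∈ S) (hτ' : τ' ∈ S) (hT : dist τ τ' ≤ T) :
    ‖∑ j ∈ J, γ j • X τ j - ∑ j ∈ J, γ j • X τ' j‖ ≤ absCirculation γ * B * T := by
  have hΓ := absCirculation_nonneg (γ := γ)
  choose! V hV hVB using hX
  have hderiv : ∀ σ ∈ S, HasDerivWithinAt (fun σ => ∑ j ∈ J, γ j • X σ j)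
      (∑ j ∈ J, γ j • V j σ) S σ := fun σ hσ =>
    HasDerivWithinAt.fun_sum fun j hj => (hV j hj σ hσ).const_smul (γ j)
  have hspeed : ∀ σ ∈ S, ‖∑ j ∈ J, γ j • V j σ‖ ≤ absCirculation γ * B := fun σ hσ =>
    calc ‖∑ j ∈ J, γ j • V j σ‖
        = ‖∑ j ∈ J, γ j • (V j σ - vortexField γ K J (X σ) j)‖ := by
          simp only [smul_sub, Finset.sum_sub_distrib, sum_smul_vortexField_eq_zero hK, sub_zero]
      _ ≤ absCirculation γ * B :=
          norm_sum_smul_le_absCirculation_mul hB fun j hj => hVB j hj σ hσ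
  calc ‖∑ j ∈ J, γ j • X τ j - ∑ j ∈ J, γ j • X τ' j‖
      ≤ absCirculation γ * B * ‖τ - τ'‖ :=
        hS.norm_image_sub_le_of_norm_hasDerivWithin_le hderiv hspeed hτ' hτ
    _ ≤ absCirculation γ * B * T := by
        rw [← dist_eq_norm]
        gcongr

/-- The points of a cluster of small diameter cannot move far from its centre of vorticity, which
exists because the circulations do not add up to zero. -/
lemma dist_le_of_diam_le (hK : K.Odd) (hJ : ∑ j ∈ J, γ j ≠ 0) (hX : IsClusterMotion γ K J B S X)
    (hB : 0 ≤ B) (hS : Convex ℝ S) {T : ℝ} {τ τ' : ℝ} (hτ : τ ∈ S) (hτ' : τ' ∈ S)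
    (hT : dist τ τ' ≤ T) {ρ : ℝ}
    (hρ : ∀ σ ∈ S, ∀ i ∈ J, ∀ j ∈ J, dist (X σ i) (X σ j) ≤ ρ) {i : ι} (hi : i ∈ J) :
    dist (X τ i) (X τ' i) ≤
      (absCirculation γ * B * T + 2 * absCirculation γ * ρ) * |∑ j ∈ J, γ j|⁻¹ := by
  have hρ0 : 0 ≤ ρ := dist_nonneg.trans (hρ τ hτ i hi i hi)
  have hdev : ∀ σ ∈ S, ‖∑ j ∈ J, γ j • (X σ i - X σ j)‖ ≤ absCirculation γ * ρ := fun σ hσ =>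
    norm_sum_smul_le_absCirculation_mul hρ0 fun j hj => by
      simpa only [dist_eq_norm] using hρ σ hσ i hi j hj
  have hsplit : (∑ j ∈ J, γ j) • (X τ i - X τ' i) =
      (∑ j ∈ J, γ j • X τ j - ∑ j ∈ J, γ j • X τ' j) +
        (∑ j ∈ J, γ j • (X τ i - X τ j) - ∑ j ∈ J, γ j • (X τ' i - X τ' j)) := by
    simp only [smul_sub, Finset.sum_sub_distrib, Finset.sum_smul]
    abel
  rw [← div_eq_mul_inv, le_div_iff₀ (abs_pos.2 hJ), dist_eq_norm, mul_comm, ← Real.norm_eq_abs,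
    ← norm_smul, hsplit]
  calc _ ≤ _ := (norm_add_le _ _).trans
        (add_le_add (hX.norm_sum_smul_sub_le hK hB hS hτ hτ' hT) (norm_sub_le _ _))
    _ ≤ _ := by linarith [hdev τ hτ, hdev τ' hτ']

/-- By the continuity method, two parts of a cluster that are once at distance `2 + 2 * D` stay at
distance at least `1` from each other, so that they form separate clusters. -/
lemma dist_le_of_separated {b D : ℝ} (hb : 0 ≤ b) (hKb : ∀ u, 1 ≤ ‖u‖ → ‖K u‖ ≤ b) (hD : 0 ≤ D)
    (hX : IsClusterMotion γ K J B S X) (hS : Convex ℝ S)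
    (hsub : ∀ I ⊂ J, ∀ S' ⊆ S, Convex ℝ S' →
      IsClusterMotion γ K I (B + absCirculation γ * b) S' X →
      ∀ k ∈ I, ∀ τ ∈ S', ∀ τ' ∈ S', dist (X τ k) (X τ' k) ≤ D)
    {I : Finset ι} (hI : I.Nonempty) (hIJ : I ⊂ J) {τ₀ : ℝ} (hτ₀ : τ₀ ∈ S)
    (hsep : ∀ k ∈ I, ∀ l ∈ J \ I, 2 + 2 * D ≤ dist (X τ₀ k) (X τ₀ l)) :
    ∀ k ∈ J, ∀ τ ∈ S, ∀ τ' ∈ S, dist (X τ k) (X τ' k) ≤ D := by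
  have hparts : ∀ S' ⊆ S, Convex ℝ S' →
      (∀ σ ∈ S', ∀ k ∈ I, ∀ l ∈ J \ I, 1 ≤ dist (X σ k) (X σ l)) →
      ∀ k ∈ J, ∀ τ ∈ S', ∀ τ' ∈ S', dist (X τ k) (X τ' k) ≤ D := by
    intro S' hS'S hS' hfar k hk
    have hXS' := hX.mono hS'S
    by_cases hkI : k ∈ I
    · exact hsub I hIJ S' hS'S hS' (hXS'.subcluster hb hKb hIJ.1 hfar) k hkI
    · refine hsub (J \ I) (Finset.sdiff_ssubset hIJ.1 hI) S' hS'S hS'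
        (hXS'.subcluster hb hKb Finset.sdiff_subset fun σ hσ k hk l hl => ?_) k
        (Finset.mem_sdiff.2 ⟨hk, hkI⟩)
      rw [Finset.sdiff_sdiff_eq_self hIJ.1] at hl
      exact dist_comm (X σ l) (X σ k) ▸ hfar σ hσ l hl k hk
  refine hparts S subset_rfl hS <| one_le_dist_of_bootstrap hS.ordConnected
    (fun k hk => hX.continuousOn (hIJ.1 hk))
    (fun l hl => hX.continuousOn (Finset.sdiff_subset hl)) hD hτ₀ hsep fun σ hσ hfar => ?_
  have hclose k hk := hparts _ (hS.ordConnected.uIcc_subset hτ₀ hσ) (convex_uIcc τ₀ σ) hfar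
    k hk τ₀ left_mem_uIcc σ right_mem_uIcc
  exact ⟨fun k hk => hclose k (hIJ.1 hk), fun l hl => hclose l (Finset.sdiff_subset hl)⟩

/-- A cluster of small diameter is controlled by its centre of vorticity; one of large diameter
splits into two parts that never interact strongly. -/
theorem dist_le_displacementBound (hγ : ∀ J : Finset ι, J.Nonempty → ∑ j ∈ J, γ j ≠ 0)
    (hK : K.Odd) {b T : ℝ} (hb : 0 ≤ b) (hKb : ∀ u, 1 ≤ ‖u‖ → ‖K u‖ ≤ b) {n : ℕ}
    (hJ : J.card ≤ n) (hX : IsClusterMotion γ K J B S X) (hB : 0 ≤ B) (hS : Convex ℝ S)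
    (hST : ∀ τ ∈ S, ∀ τ' ∈ S, dist τ τ' ≤ T) {j : ι} (hj : j ∈ J) {τ τ' : ℝ} (hτ : τ ∈ S)
    (hτ' : τ' ∈ S) : dist (X τ j) (X τ' j) ≤ displacementBound γ b T n B := by
  induction n generalizing B S J j τ τ' with
  | zero => simp [Finset.card_eq_zero.1 (Nat.le_zero.1 hJ)] at hj
  | succ n ih =>
    have hΓ := absCirculation_nonneg (γ := γ)
    have hT : 0 ≤ T := dist_nonneg.trans (hST τ hτ τ hτ)
    rw [displacementBound]
    set D := displacementBound γ b T n (B + absCirculation γ * b)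
    have hD : 0 ≤ D := displacementBound_nonneg hb hT n (by positivity)
    by_cases hdiam : ∀ σ ∈ S, ∀ i ∈ J, ∀ j ∈ J, dist (X σ i) (X σ j) ≤ (n + 2) * (2 + 2 * D)
    · have hle : |∑ j ∈ J, γ j|⁻¹ ≤ ∑ J : Finset ι, |∑ j ∈ J, γ j|⁻¹ :=
        Finset.single_le_sum (f := fun J : Finset ι => |∑ j ∈ J, γ j|⁻¹)
          (fun _ _ => by positivity) (Finset.mem_univ J)
      refine (hX.dist_le_of_diam_le hK (hγ J ⟨j, hj⟩) hB hS hτ hτ' (hST τ hτ τ' hτ') hdiam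
        hj).trans ?_
      exact (mul_le_mul_of_nonneg_left hle (by positivity)).trans (le_add_of_nonneg_left hD)
    push Not at hdiam
    obtain ⟨τ₀, hτ₀, i, hi, k, hk, hik⟩ := hdiam
    obtain ⟨I, hIJ, hI, hsep⟩ := exists_separated_partition J (X τ₀)
      (r := 2 + 2 * D) (by positivity) hi hk <| hik.le.trans' <| by
        have : (J.card : ℝ) ≤ n + 1 := by exact_mod_cast hJ
        gcongr ?_ * _
        linarith
    refine (hX.dist_le_of_separated hb hKb hD hS ?_ hI hIJ hτ₀ hsep j hj τ hτ τ' hτ').trans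
      (le_add_of_nonneg_right (by positivity))
    exact fun I hIJ S' hS'S hS' hXI k hk τ hτ τ' hτ' =>
      ih (Nat.le_of_lt_succ ((Finset.card_lt_card hIJ).trans_le hJ)) hXI (by positivity) hS'
        (fun τ hτ τ' hτ' => hST τ (hS'S hτ) τ' (hS'S hτ')) hk hτ hτ'

end IsClusterMotion

end Displacement

section Euler

variable {E : Type*} [NormedAddCommGroup E] [NormedSpace ℝ E]

/-- One step of length `h` of the explicit Euler scheme for the vector field `V`. -/
def eulerStep (V : E → E) (h : ℝ) (x : E) : E :=
  x + h • V x

variable {V : E → E} {L : ℝ≥0} {h : ℝ}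

lemma norm_eulerStep_sub_le (hL : LipschitzWith L V) (hh : 0 ≤ h) (x y : E) :
    ‖eulerStep V h x - eulerStep V h y‖ ≤ (1 + L * h) * ‖x - y‖ :=
  calc ‖eulerStep V h x - eulerStep V h y‖ = ‖(x - y) + h • (V x - V y)‖ := by
        simp only [eulerStep, smul_sub]; congr 1; abel
    _ ≤ ‖x - y‖ + h * ‖V x - V y‖ := by
        grw [norm_add_le, norm_smul, Real.norm_of_nonneg hh]
    _ ≤ ‖x - y‖ + h * (L * ‖x - y‖) := by gcongr; exact hL.norm_sub_le x y
    _ = (1 + L * h) * ‖x - y‖ := by ring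

lemma eulerStep_injective (hL : LipschitzWith L V) (hh : 0 ≤ h) (hLh : L * h < 1) :
    (eulerStep V h).Injective := by
  intro x y hxy
  have hdiff : x - y = h • (V y - V x) := by
    rw [smul_sub, sub_eq_sub_iff_add_eq_add, add_comm _ y]
    exact hxy
  have hle : ‖x - y‖ ≤ L * h * ‖x - y‖ :=
    calc ‖x - y‖ = h * ‖V y - V x‖ := by rw [hdiff, norm_smul, Real.norm_of_nonneg hh]
      _ ≤ h * (L * ‖y - x‖) := by gcongr; exact hL.norm_sub_le y x
      _ = L * h * ‖x - y‖ := by rw [norm_sub_rev]; ring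
  refine sub_eq_zero.1 (norm_eq_zero.1 ?_)
  nlinarith [norm_nonneg (x - y)]

variable {M : ℝ} {X : ℝ → E} {T : ℝ}

lemma norm_sub_eulerStep_le (hL : LipschitzWith L V) (hM : ∀ x, ‖V x‖ ≤ M)
    (hX : ∀ τ ∈ Icc 0 T, HasDerivWithinAt X (V (X τ)) (Icc 0 T) τ) {s : ℝ} (hs : 0 ≤ s)
    (hh : 0 ≤ h) (hsT : s + h ≤ T) :
    ‖X (s + h) - eulerStep V h (X s)‖ ≤ L * M * h ^ 2 := by
  have hM0 : 0 ≤ M := (norm_nonneg _).trans (hM 0)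
  have hsub : Icc s (s + h) ⊆ Icc 0 T := Icc_subset_Icc hs hsT
  replace hX : ∀ τ ∈ Icc s (s + h), HasDerivWithinAt X (V (X τ)) (Icc s (s + h)) τ :=
    fun τ hτ => (hX τ (hsub hτ)).mono hsub
  have hs' : s ∈ Icc s (s + h) := left_mem_Icc.2 (by linarith)
  have hmove : ∀ τ ∈ Icc s (s + h), ‖X τ - X s‖ ≤ M * h := fun τ hτ =>
    calc ‖X τ - X s‖ ≤ M * ‖τ - s‖ :=
          (convex_Icc s (s + h)).norm_image_sub_le_of_norm_hasDerivWithin_le hX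
            (fun σ _ => hM (X σ)) hs' hτ
      _ ≤ M * h := by
          rw [Real.norm_of_nonneg (by linarith [hτ.1])]
          gcongr
          linarith [hτ.2]
  have hderiv : ∀ τ ∈ Icc s (s + h), HasDerivWithinAt (fun τ => X τ - τ • V (X s))
      (V (X τ) - V (X s)) (Icc s (s + h)) τ := fun τ hτ => by
    simpa using! (hX τ hτ).sub ((hasDerivWithinAt_id τ _).smul_const (V (X s)))
  have hspeed : ∀ τ ∈ Icc s (s + h), ‖V (X τ) - V (X s)‖ ≤ L * (M * h) := fun τ hτ =>
    (hL.norm_sub_le _ _).trans (by gcongr; exact hmove τ hτ)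
  calc ‖X (s + h) - eulerStep V h (X s)‖
      = ‖X (s + h) - (s + h) • V (X s) - (X s - s • V (X s))‖ := by
        rw [eulerStep, add_smul]; congr 1; abel
    _ ≤ L * (M * h) * ‖s + h - s‖ :=
        (convex_Icc s (s + h)).norm_image_sub_le_of_norm_hasDerivWithin_le hderiv hspeed hs'
          (right_mem_Icc.2 (by linarith))
    _ = L * M * h ^ 2 := by rw [add_sub_cancel_left, Real.norm_of_nonneg hh]; ring

lemma norm_sub_iterate_eulerStep_le (hL : LipschitzWith L V) (hM : ∀ x, ‖V x‖ ≤ M)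
    (hX : ∀ τ ∈ Icc 0 T, HasDerivWithinAt X (V (X τ)) (Icc 0 T) τ) (hh : 0 ≤ h) {k : ℕ}
    (hk : k * h ≤ T) :
    ‖X (k * h) - (eulerStep V h)^[k] (X 0)‖ ≤ k * (L * M * h ^ 2) * (1 + L * h) ^ k := by
  have hM0 : 0 ≤ M := (norm_nonneg _).trans (hM 0)
  induction k with
  | zero => simp
  | succ k ih =>
    push_cast at hk ⊢
    rw [add_one_mul] at hk ⊢
    have hone : (1 : ℝ) ≤ (1 + L * h) ^ (k + 1) :=
      one_le_pow₀ (le_add_of_nonneg_right (by positivity))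
    rw [Function.iterate_succ_apply']
    calc _ ≤ ‖X (k * h + h) - eulerStep V h (X (k * h))‖ +
          ‖eulerStep V h (X (k * h)) - eulerStep V h ((eulerStep V h)^[k] (X 0))‖ :=
          norm_sub_le_norm_sub_add_norm_sub _ _ _
      _ ≤ L * M * h ^ 2 + (1 + L * h) * (k * (L * M * h ^ 2) * (1 + L * h) ^ k) := by
          gcongr
          · exact norm_sub_eulerStep_le hL hM hX (by positivity) hh hk
          · exact (norm_eulerStep_sub_le hL hh _ _).trans (by gcongr; exact ih (by linarith))
      _ ≤ L * M * h ^ 2 * (1 + L * h) ^ (k + 1) +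
          (1 + L * h) * (k * (L * M * h ^ 2) * (1 + L * h) ^ k) := by
          gcongr ?_ + _
          exact le_mul_of_one_le_right (by positivity) hone
      _ = _ := by ring

lemma tendsto_iterate_eulerStep (hL : LipschitzWith L V) (hM : ∀ x, ‖V x‖ ≤ M) (hT : 0 ≤ T)
    (hX : ∀ τ ∈ Icc 0 T, HasDerivWithinAt X (V (X τ)) (Icc 0 T) τ) :
    Tendsto (fun n : ℕ => (eulerStep V (T / n))^[n] (X 0)) atTop (𝓝 (X T)) := by
  have hM0 : 0 ≤ M := (norm_nonneg _).trans (hM 0)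
  rw [tendsto_iff_norm_sub_tendsto_zero]
  refine squeeze_zero' (Eventually.of_forall fun _ => norm_nonneg _) ?_
    (tendsto_const_div_atTop_nhds_zero_nat (L * M * T ^ 2 * Real.exp (L * T)))
  filter_upwards [eventually_gt_atTop 0] with n hn
  have hnT : (n : ℝ) * (T / n) = T := mul_div_cancel₀ T (by positivity)
  have hexp : (1 + L * (T / n)) ^ n ≤ Real.exp (L * T) :=
    calc (1 + L * (T / n)) ^ n ≤ Real.exp (L * (T / n)) ^ n := by
          gcongr
          rw [add_comm]
          exact Real.add_one_le_exp _
      _ = Real.exp (L * T) := by rw [← Real.exp_nat_mul, mul_left_comm, hnT]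
  have herr := norm_sub_iterate_eulerStep_le hL hM hX (h := T / n) (by positivity) hnT.le
  rw [hnT, norm_sub_rev] at herr
  calc _ ≤ _ := herr
    _ ≤ n * (L * M * (T / n) ^ 2) * Real.exp (L * T) := by gcongr
    _ = L * M * T ^ 2 * Real.exp (L * T) / n := by field_simp

end Euler

section Liouville

section Determinant

variable {E : Type*} [NormedAddCommGroup E] [NormedSpace ℝ E] [FiniteDimensional ℝ E]

lemma differentiable_det : Differentiable ℝ (fun A : E →L[ℝ] E => A.det) := by
  let b := Module.finBasis ℝ E
  have hdet : (fun A : E →L[ℝ] E => A.det) = fun A : E →L[ℝ] E =>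
      ∑ σ : Equiv.Perm (Fin (Module.finrank ℝ E)), ((Equiv.Perm.sign σ : ℤ) : ℝ) *
        ∏ i, LinearMap.toMatrix b b (A : E →ₗ[ℝ] E) (σ i) i := by
    ext A
    rw [ContinuousLinearMap.det, ← LinearMap.det_toMatrix b, Matrix.det_apply']
  have hentry : ∀ i j, Differentiable ℝ
      (fun A : E →L[ℝ] E => LinearMap.toMatrix b b (A : E →ₗ[ℝ] E) i j) := fun i j => by
    simpa only [LinearMap.toMatrix_apply] using!
      (LinearMap.toContinuousLinearMap (b.coord i)).differentiable.comp
        (ContinuousLinearMap.apply ℝ E (b j)).differentiable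
  rw [hdet]
  exact Differentiable.fun_sum fun σ _ => (differentiable_const _).mul fun A =>
    (HasFDerivAt.finsetProd fun i _ => (hentry (σ i) i A).hasFDerivAt).differentiableAt

lemma hasDerivAt_det_one_add_smul (A : E →L[ℝ] E) :
    HasDerivAt (fun r : ℝ => (1 + r • A).det) (LinearMap.trace ℝ E A) 0 := by
  let b := Module.finBasis ℝ E
  set Q := LinearMap.toMatrix b b (A : E →ₗ[ℝ] E)
  set P := (1 + (Polynomial.X : Polynomial ℝ) • Q.map Polynomial.C).det
  have hcharpoly : (fun r : ℝ => (1 + r • A).det) = fun r => P.eval r := by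
    ext r
    have hmatrix : LinearMap.toMatrix b b ((1 + r • A : E →L[ℝ] E) : E →ₗ[ℝ] E) = 1 + r • Q := by
      rw [ContinuousLinearMap.toLinearMap_add, ContinuousLinearMap.toLinearMap_smul, map_add,
        map_smul]
      congr 1
      exact LinearMap.toMatrix_one b
    have hexpand := congrArg (Polynomial.eval r) (Matrix.det_one_add_X_smul Q)
    rw [ContinuousLinearMap.det, ← LinearMap.det_toMatrix b, hmatrix, Matrix.det_one_add_smul,
      hexpand]
    simp only [Polynomial.eval_add, Polynomial.eval_one, Polynomial.eval_smul, Polynomial.eval_X,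
      Polynomial.eval_mul, Polynomial.eval_pow, smul_eq_mul]
  rw [hcharpoly, LinearMap.trace_eq_matrix_trace ℝ b, ← Matrix.derivative_det_one_add_X_smul]
  exact P.hasDerivAt 0

lemma eventually_one_sub_le_det_one_add {ε : ℝ} (hε : 0 < ε) :
    ∀ᶠ A : E →L[ℝ] E in 𝓝 0, LinearMap.trace ℝ E A = 0 → 1 - ε * ‖A‖ ≤ (1 + A).det := by
  have hdiff : DifferentiableAt ℝ (fun A : E →L[ℝ] E => (1 + A).det) 0 :=
    (differentiable_det (E := E)).differentiableAt.comp 0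
      ((differentiableAt_const _).add differentiableAt_id)
  have htrace : ∀ A : E →L[ℝ] E, fderiv ℝ (fun A : E →L[ℝ] E => (1 + A).det) 0 A =
      LinearMap.trace ℝ E A := fun A => by
    rw [← (hasDerivAt_det_one_add_smul A).deriv, ← hdiff.lineDeriv_eq_fderiv, lineDeriv]
    simp
  filter_upwards [hdiff.hasFDerivAt.isLittleO.def hε] with A hA hA0
  have hone : (1 : E →L[ℝ] E).det = 1 := LinearMap.det_id
  simp only [sub_zero, htrace, hA0, add_zero, hone, Real.norm_eq_abs] at hA
  linarith [(abs_le.1 hA).1]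

end Determinant

/-- A bounded Lipschitz vector field of divergence zero. -/
structure IsIncompressibleField {E : Type*} [NormedAddCommGroup E] [NormedSpace ℝ E]
    (V : E → E) : Prop where
  differentiable : Differentiable ℝ V
  lipschitz : ∃ L, LipschitzWith L V
  bounded : ∃ M, ∀ x, ‖V x‖ ≤ M
  trace_fderiv : ∀ x, LinearMap.trace ℝ E (fderiv ℝ V x) = 0

/-- `X x` is, for every `x ∈ S`, the trajectory of `V` that starts at `x`, up to time `T`. -/
structure IsFlowOn {E : Type*} [NormedAddCommGroup E] [NormedSpace ℝ E]
    (V : E → E) (S : Set E) (T : ℝ) (X : E → ℝ → E) : Prop where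
  initial : ∀ x ∈ S, X x 0 = x
  motion : ∀ x ∈ S, ∀ τ ∈ Icc 0 T, HasDerivWithinAt (X x) (V (X x τ)) (Icc 0 T) τ

lemma mul_lintegral_comp_iterate_le {α : Type*} [MeasurableSpace α] {μ : Measure α} {f : α → α}
    {a : ℝ≥0∞} (hf : ∀ g : α → ℝ≥0∞, a * ∫⁻ x, g (f x) ∂μ ≤ ∫⁻ x, g x ∂μ) (n : ℕ)
    (g : α → ℝ≥0∞) : a ^ n * ∫⁻ x, g (f^[n] x) ∂μ ≤ ∫⁻ x, g x ∂μ := by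
  induction n with
  | zero => simp
  | succ n ih =>
    calc a ^ (n + 1) * ∫⁻ x, g (f^[n + 1] x) ∂μ = a ^ n * (a * ∫⁻ x, g (f^[n] (f x)) ∂μ) := by
          simp only [Function.iterate_succ_apply, pow_succ, mul_assoc]
      _ ≤ a ^ n * ∫⁻ x, g (f^[n] x) ∂μ := by gcongr; exact hf fun x => g (f^[n] x)
      _ ≤ ∫⁻ x, g x ∂μ := ih

variable {E : Type*} [NormedAddCommGroup E] [NormedSpace ℝ E] {V : E → E}

section FiniteDimensional

variable [FiniteDimensional ℝ E] [MeasurableSpace E] [BorelSpace E] {μ : Measure E}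
  [μ.IsAddHaarMeasure]

namespace IsIncompressibleField

lemma eventually_mul_lintegral_comp_eulerStep_le (hV : IsIncompressibleField V) {ε : ℝ}
    (hε : 0 < ε) :
    ∀ᶠ h in 𝓝[≥] (0 : ℝ), ∀ g : E → ℝ≥0∞,
      ENNReal.ofReal (1 - ε * h) * ∫⁻ x, g (eulerStep V h x) ∂μ ≤ ∫⁻ x, g x ∂μ := by
  obtain ⟨L, hL⟩ := hV.lipschitz
  obtain ⟨δ, hδ, hdet⟩ := Metric.eventually_nhds_iff.1
    (eventually_one_sub_le_det_one_add (E := E) (ε := ε / (L + 1)) (by positivity))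
  have hsmall : ∀ᶠ h in 𝓝[≥] (0 : ℝ), L * h < min δ 1 := by
    refine nhdsWithin_le_nhds (ContinuousAt.eventually_lt (by fun_prop) continuousAt_const ?_)
    simpa using hδ
  filter_upwards [hsmall, self_mem_nhdsWithin] with h hLh h0 g
  have hderiv : ∀ x ∈ (univ : Set E), HasFDerivWithinAt (eulerStep V h)
      (1 + h • fderiv ℝ V x) univ x := fun x _ =>
    ((hasFDerivAt_id x).add ((hV.differentiable x).hasFDerivAt.const_smul h)).hasFDerivWithinAt
  have hjacobian : ∀ x, 1 - ε * h ≤ (1 + h • fderiv ℝ V x).det := by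
    intro x
    have hnorm : ‖h • fderiv ℝ V x‖ ≤ L * h := by
      rw [norm_smul, Real.norm_of_nonneg h0, mul_comm]
      gcongr
      exact norm_fderiv_le_of_lipschitz ℝ hL
    refine le_trans ?_ (hdet (by simpa using hnorm.trans_lt (hLh.trans_le (min_le_left _ _)))
      (by simp [hV.trace_fderiv x]))
    have : ε / (L + 1) * ‖h • fderiv ℝ V x‖ ≤ ε / (L + 1) * ((L + 1) * h) := by
      gcongr
      linarith [show (0 : ℝ) ≤ h from h0]
    linarith [show ε / (L + 1) * ((L + 1) * h) = ε * h by field_simp]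
  calc ENNReal.ofReal (1 - ε * h) * ∫⁻ x, g (eulerStep V h x) ∂μ
      = ∫⁻ x, ENNReal.ofReal (1 - ε * h) * g (eulerStep V h x) ∂μ :=
        (lintegral_const_mul' _ _ ENNReal.ofReal_ne_top).symm
    _ ≤ ∫⁻ x, ENNReal.ofReal |(1 + h • fderiv ℝ V x).det| * g (eulerStep V h x) ∂μ := by
        gcongr with x
        exact (hjacobian x).trans (le_abs_self _)
    _ = ∫⁻ x in eulerStep V h '' univ, g x ∂μ := by
        rw [lintegral_image_eq_lintegral_abs_det_fderiv_mul μ MeasurableSet.univ hderiv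
          (eulerStep_injective hL h0 (hLh.trans_le (min_le_right _ _))).injOn g,
          Measure.restrict_univ]
    _ ≤ ∫⁻ x, g x ∂μ := setLIntegral_le_lintegral _ _

lemma eventually_mul_lintegral_comp_iterate_eulerStep_le (hV : IsIncompressibleField V) {t : ℝ}
    (ht : 0 ≤ t) {a : ℝ≥0∞} (ha : a < 1) :
    ∀ᶠ n : ℕ in atTop, ∀ g : E → ℝ≥0∞,
      a * ∫⁻ x, g ((eulerStep V (t / n))^[n] x) ∂μ ≤ ∫⁻ x, g x ∂μ := by
  have ha1 : a.toReal < 1 := ENNReal.toReal_lt_of_lt_ofReal (by simpa using ha)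
  obtain ⟨ε, hε, hεt⟩ : ∃ ε > 0, ε * t ≤ 1 - a.toReal :=
    ⟨(1 - a.toReal) / (t + 1), div_pos (by linarith) (by linarith), by
      rw [div_mul_eq_mul_div, div_le_iff₀ (by linarith)]
      nlinarith⟩
  have hlim : Tendsto (fun n : ℕ => t / (n : ℝ)) atTop (𝓝[≥] 0) :=
    tendsto_nhdsWithin_iff.2 ⟨tendsto_const_div_atTop_nhds_zero_nat t,
      Eventually.of_forall fun n => div_nonneg ht n.cast_nonneg⟩
  filter_upwards [hlim.eventually (hV.eventually_mul_lintegral_comp_eulerStep_le (μ := μ) hε),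
    eventually_gt_atTop 0] with n hstep hn g
  refine le_trans ?_ (mul_lintegral_comp_iterate_le hstep n g)
  gcongr
  have hn1 : (1 : ℝ) ≤ n := by exact_mod_cast hn
  have hεn : ε * (t / n) ≤ 1 :=
    calc ε * (t / n) ≤ ε * t := by gcongr; exact div_le_self ht hn1
      _ ≤ 1 := hεt.trans (by linarith [a.toReal_nonneg])
  rw [← ENNReal.ofReal_pow (by linarith), ← ENNReal.ofReal_toReal ha.ne_top]
  refine ENNReal.ofReal_le_ofReal ?_
  calc a.toReal ≤ 1 + n * -(ε * (t / n)) := by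
        rw [show (n : ℝ) * -(ε * (t / n)) = -(ε * t) by field_simp]
        linarith
    _ ≤ (1 + -(ε * (t / n))) ^ n := one_add_mul_le_pow (by linarith) n
    _ = (1 - ε * (t / n)) ^ n := by rw [← sub_eq_add_neg]

/-- **Liouville's theorem** as an inequality, which suffices below and only needs Fatou's lemma: the
Euler scheme converges to the flow and each of its steps almost preserves volume. -/
theorem lintegral_comp_flow_le (hV : IsIncompressibleField V) {S U : Set E}
    (hS : MeasurableSet S) (hU : IsOpen U) {t : ℝ} (ht : 0 ≤ t) {X : E → ℝ → E}
    (hX : IsFlowOn V S t X) (hXU : ∀ x ∈ S, X x t ∈ U) {g : E → ℝ≥0∞}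
    (hg : LowerSemicontinuous g) :
    ∫⁻ x in S, g (X x t) ∂μ ≤ ∫⁻ x in U, g x ∂μ := by
  obtain ⟨L, hL⟩ := hV.lipschitz
  obtain ⟨M, hM⟩ := hV.bounded
  rw [← lintegral_indicator hU.measurableSet]
  set F : ℕ → E → E := fun n => (eulerStep V (t / n))^[n]
  have hF : ∀ n, Measurable (F n) := fun n =>
    (continuous_id.add (hL.continuous.const_smul _)).measurable.iterate n
  have hliminf : ∀ x ∈ S, g (X x t) ≤ liminf (fun n => U.indicator g (F n x)) atTop := by
    intro x hx
    have hlim := tendsto_iterate_eulerStep hL hM ht (hX.motion x hx)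
    rw [hX.initial x hx] at hlim
    refine (le_liminf_iff).2 fun y hy => ?_
    filter_upwards [hlim (hU.mem_nhds (hXU x hx)), hlim (hg (X x t) y hy)] with n hnU hny
    exact (indicator_of_mem (show F n x ∈ U from hnU) g).symm ▸ hny
  have hfatou : ∫⁻ x in S, g (X x t) ∂μ ≤ liminf (fun n => ∫⁻ x, U.indicator g (F n x) ∂μ) atTop :=
    calc ∫⁻ x in S, g (X x t) ∂μ ≤ ∫⁻ x in S, liminf (fun n => U.indicator g (F n x)) atTop ∂μ :=
          setLIntegral_mono' hS hliminf
      _ ≤ ∫⁻ x, liminf (fun n => U.indicator g (F n x)) atTop ∂μ := setLIntegral_le_lintegral _ _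
      _ ≤ _ := lintegral_liminf_le fun n =>
          (hg.measurable.indicator hU.measurableSet).comp (hF n)
  refine hfatou.trans (ENNReal.le_of_forall_lt_one_mul_le fun a ha => ?_)
  rw [← ENNReal.liminf_const_mul_of_ne_top (ha.ne_top)]
  exact liminf_le_of_frequently_le' <| Eventually.frequently <|
    (hV.eventually_mul_lintegral_comp_iterate_eulerStep_le ht ha).mono fun n hn => hn _

end IsIncompressibleField

end FiniteDimensional

end Liouville

section Kernel

section FullField

variable {ι E : Type*} [Fintype ι] [DecidableEq ι] [NormedAddCommGroup E] [NormedSpace ℝ E]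
  {γ : ι → ℝ} {K : E → E}

lemma contDiff_vortexField (hK : ContDiff ℝ ∞ K) (J : Finset ι) :
    ContDiff ℝ ∞ (vortexField γ K J) := by
  refine contDiff_pi.2 fun j => ContDiff.sum fun k _ => ContDiff.const_smul _ (hK.comp ?_)
  exact (contDiff_apply ℝ E j).sub (contDiff_apply ℝ E k)

lemma norm_vortexField_le {M : ℝ} (hM : ∀ u, ‖K u‖ ≤ M) (J : Finset ι) (x : ι → E) :
    ‖vortexField γ K J x‖ ≤ absCirculation γ * M := by
  have hM0 : 0 ≤ M := (norm_nonneg _).trans (hM 0)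
  exact (pi_norm_le_iff_of_nonneg (mul_nonneg (absCirculation_nonneg) hM0)).2 fun j =>
    norm_sum_smul_le_absCirculation_mul hM0 fun k _ => hM _

lemma lipschitzWith_vortexField {L : ℝ≥0} (hL : LipschitzWith L K) (J : Finset ι) :
    LipschitzWith (absCirculation γ * (2 * L)).toNNReal (vortexField γ K J) := by
  refine LipschitzWith.of_dist_le' fun x y => ?_
  have hdiff : ∀ j k, ‖K (x j - x k) - K (y j - y k)‖ ≤ 2 * L * ‖x - y‖ := fun j k =>
    calc ‖K (x j - x k) - K (y j - y k)‖ ≤ L * ‖x j - x k - (y j - y k)‖ := hL.norm_sub_le _ _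
      _ = L * ‖(x - y) j - (x - y) k‖ := by rw [sub_sub_sub_comm, Pi.sub_apply, Pi.sub_apply]
      _ ≤ L * (‖x - y‖ + ‖x - y‖) := by
          gcongr
          exact norm_sub_le_of_le (norm_le_pi_norm _ _) (norm_le_pi_norm _ _)
      _ = 2 * L * ‖x - y‖ := by ring
  rw [dist_eq_norm, dist_eq_norm, mul_assoc]
  refine (pi_norm_le_iff_of_nonneg (mul_nonneg (absCirculation_nonneg) (by positivity))).2
    fun j => ?_
  simp only [Pi.sub_apply, vortexField, ← Finset.sum_sub_distrib, ← smul_sub]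
  exact norm_sum_smul_le_absCirculation_mul (by positivity) fun k _ => hdiff j k

variable [FiniteDimensional ℝ E]

lemma trace_pi (A : ι → (ι → E) →L[ℝ] E) :
    LinearMap.trace ℝ (ι → E) (ContinuousLinearMap.pi A) =
      ∑ j, LinearMap.trace ℝ E (A j ∘ₗ LinearMap.single ℝ (fun _ : ι => E) j) := by
  have hblocks : ((ContinuousLinearMap.pi A : (ι → E) →L[ℝ] (ι → E)) : (ι → E) →ₗ[ℝ] (ι → E)) =
      ∑ j, LinearMap.single ℝ (fun _ : ι => E) j ∘ₗ (A j : (ι → E) →ₗ[ℝ] E) := by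
    refine LinearMap.ext fun v => funext fun i => ?_
    simp [LinearMap.sum_apply, Finset.sum_apply, Pi.single_apply]
  rw [hblocks, map_sum]
  exact Finset.sum_congr rfl fun j _ => LinearMap.trace_comp_comm' _ _

omit [Fintype ι] in
/-- The velocity of a vortex does not depend on its own position except through `K`, so each
diagonal block of the derivative is a combination of derivatives of `K`. -/
lemma trace_fderiv_vortexField [Finite ι] (hK : Differentiable ℝ K)
    (hdiv : ∀ u, LinearMap.trace ℝ E (fderiv ℝ K u) = 0) (J : Finset ι) (x : ι → E) :
    LinearMap.trace ℝ (ι → E) (fderiv ℝ (vortexField γ K J) x) = 0 := by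
  have := Fintype.ofFinite ι
  set pr : ι → (ι → E) →L[ℝ] E := fun j => ContinuousLinearMap.proj j
  set A : ι → (ι → E) →L[ℝ] E := fun j =>
    ∑ k ∈ J.erase j, γ k • (fderiv ℝ K (x j - x k)).comp (pr j - pr k) with hA
  have hderiv : HasFDerivAt (vortexField γ K J) (ContinuousLinearMap.pi A) x :=
    hasFDerivAt_pi.2 fun j => HasFDerivAt.fun_sum fun k _ =>
      ((hK (x j - x k)).hasFDerivAt.comp x
        ((hasFDerivAt_apply j x).sub (hasFDerivAt_apply k x))).const_smul (γ k)
  rw [hderiv.fderiv, trace_pi]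
  refine Finset.sum_eq_zero fun j _ => ?_
  have hblock : (A j : (ι → E) →ₗ[ℝ] E) ∘ₗ LinearMap.single ℝ (fun _ : ι => E) j =
      ∑ k ∈ J.erase j, γ k • (fderiv ℝ K (x j - x k) : E →ₗ[ℝ] E) := by
    refine LinearMap.ext fun v => ?_
    simp only [hA, LinearMap.comp_apply, ContinuousLinearMap.coe_coe, LinearMap.sum_apply,
      _root_.sum_apply]
    refine Finset.sum_congr rfl fun k hk => ?_
    simp [pr, (Finset.mem_erase.1 hk).1]
  rw [hblock, map_sum]
  exact Finset.sum_eq_zero fun k _ => by rw [map_smul, hdiv, smul_zero]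

lemma isIncompressibleField_vortexField (hK : ContDiff ℝ ∞ K) (hKc : HasCompactSupport K)
    (hdiv : ∀ u, LinearMap.trace ℝ E (fderiv ℝ K u) = 0) (J : Finset ι) :
    IsIncompressibleField (vortexField γ K J) where
  differentiable := (contDiff_vortexField hK J).differentiable (by simp)
  lipschitz := by
    obtain ⟨L, hL⟩ := hK.lipschitzWith_of_hasCompactSupport hKc (by simp)
    exact ⟨_, lipschitzWith_vortexField hL J⟩
  bounded := by
    obtain ⟨M, hM⟩ := hKc.exists_bound_of_continuous hK.continuous
    exact ⟨_, norm_vortexField_le hM J⟩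
  trace_fderiv := trace_fderiv_vortexField (hK.differentiable (by simp)) hdiv J

end FullField

variable {E : Type*} [NormedAddCommGroup E] [InnerProductSpace ℝ E] {K K' : E → E} {ε R : ℝ}

/-- An interaction kernel of point vortex type: odd, orthogonal to the line joining the two points,
and smooth and divergence free away from the origin. -/
structure IsVortexKernel (K : E → E) : Prop where
  odd : K.Odd
  inner_self : ∀ u, inner ℝ u (K u) = 0
  contDiffOn : ContDiffOn ℝ ∞ K {0}ᶜ
  trace_fderiv : ∀ u ≠ 0, LinearMap.trace ℝ E (fderiv ℝ K u) = 0

/-- `K'` is a smooth compactly supported kernel of point vortex type that is dominated by `K` and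
agrees with `K` at distances between `ε` and `R`. -/
structure IsTruncation (K : E → E) (ε R : ℝ) (K' : E → E) : Prop where
  odd : K'.Odd
  inner_self : ∀ u, inner ℝ u (K' u) = 0
  contDiff : ContDiff ℝ ∞ K'
  trace_fderiv : ∀ u, LinearMap.trace ℝ E (fderiv ℝ K' u) = 0
  hasCompactSupport : HasCompactSupport K'
  norm_le : ∀ u, ‖K' u‖ ≤ ‖K u‖
  eq_self : ∀ u, ε ≤ ‖u‖ → ‖u‖ ≤ R → K' u = K u

lemma IsVortexKernel.contDiffAt (hK : IsVortexKernel K) {u : E} (hu : u ≠ 0) :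
    ContDiffAt ℝ ∞ K u :=
  hK.contDiffOn.contDiffAt (isOpen_compl_singleton.mem_nhds hu)

variable [FiniteDimensional ℝ E]

/-- The gradient of a radial factor is radial, hence orthogonal to `K`. -/
lemma trace_fderiv_comp_norm_sq_smul {χ : ℝ → ℝ} {u : E} (hχ : DifferentiableAt ℝ χ (‖u‖ ^ 2))
    (hK : DifferentiableAt ℝ K u) (hinner : inner ℝ u (K u) = 0) :
    LinearMap.trace ℝ E (fderiv ℝ (fun v => χ (‖v‖ ^ 2) • K v) u) =
      χ (‖u‖ ^ 2) * LinearMap.trace ℝ E (fderiv ℝ K u) := by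
  have hradial : HasFDerivAt (fun v : E => χ (‖v‖ ^ 2))
      (deriv χ (‖u‖ ^ 2) • (2 • innerSL ℝ u)) u :=
    hχ.hasDerivAt.comp_hasFDerivAt u (hasStrictFDerivAt_norm_sq u).hasFDerivAt
  rw [(hradial.fun_smul hK.hasFDerivAt).fderiv, ContinuousLinearMap.toLinearMap_add, map_add,
    ContinuousLinearMap.toLinearMap_smul, map_smul, smul_eq_mul]
  have hrank : ((deriv χ (‖u‖ ^ 2) • (2 • innerSL ℝ u)).smulRight (K u) : E →ₗ[ℝ] E) =
      LinearMap.smulRight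
        ((deriv χ (‖u‖ ^ 2) • (2 • innerSL ℝ u) : E →L[ℝ] ℝ) : E →ₗ[ℝ] ℝ) (K u) := rfl
  rw [hrank, LinearMap.trace_smulRight]
  simp [hinner]

lemma exists_radial_cutoff (hε : 0 < ε) (hεR : ε < R) :
    ∃ χ : ℝ → ℝ, ContDiff ℝ ∞ χ ∧ (∀ s, 0 ≤ χ s ∧ χ s ≤ 1) ∧
      (∀ s ∈ Icc (ε ^ 2) (R ^ 2), χ s = 1) ∧ (∀ s < ε ^ 2 / 2, χ s = 0) ∧
      ∀ s, R ^ 2 + ε ^ 2 ≤ s → χ s = 0 := by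
  have hlt : ε ^ 2 < R ^ 2 := by gcongr
  have hε2 : 0 < ε ^ 2 := by positivity
  let χ : ContDiffBump ((ε ^ 2 + R ^ 2) / 2) :=
    { rIn := (R ^ 2 - ε ^ 2) / 2
      rOut := R ^ 2 / 2
      rIn_pos := by linarith
      rIn_lt_rOut := by linarith }
  have hzero : ∀ s, R ^ 2 / 2 ≤ |s - (ε ^ 2 + R ^ 2) / 2| → χ s = 0 := fun s hs =>
    χ.zero_of_le_dist (by rwa [Real.dist_eq])
  refine ⟨χ, χ.contDiff, fun s => ⟨χ.nonneg, χ.le_one⟩, fun s hs => ?_, fun s hs => ?_,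
    fun s hs => ?_⟩
  · refine χ.one_of_mem_closedBall ?_
    rw [Metric.mem_closedBall, Real.dist_eq, abs_le]
    constructor <;> linarith [hs.1, hs.2, show χ.rIn = (R ^ 2 - ε ^ 2) / 2 from rfl]
  · exact hzero s (le_trans (by linarith) (neg_le_abs _))
  · exact hzero s (le_trans (by linarith) (le_abs_self _))

lemma IsVortexKernel.exists_isTruncation (hK : IsVortexKernel K) (hε : 0 < ε) (hεR : ε < R) :
    ∃ K', IsTruncation K ε R K' := by
  obtain ⟨χ, hχ, hχ01, hχ1, hχ_near, hχ_far⟩ := exists_radial_cutoff hε hεR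
  let K' : E → E := fun u => χ (‖u‖ ^ 2) • K u
  have hK' : ∀ u, K' u = χ (‖u‖ ^ 2) • K u := fun _ => rfl
  have hzero : K' =ᶠ[𝓝 0] fun _ => 0 := by
    have hnear : ∀ᶠ u : E in 𝓝 0, ‖u‖ ^ 2 < ε ^ 2 / 2 :=
      ((continuous_norm.pow 2).tendsto' 0 0 (by simp)).eventually_lt_const (by positivity)
    filter_upwards [hnear] with u hu
    rw [hK', hχ_near _ hu, zero_smul]
  refine ⟨K', fun u => ?_, fun u => ?_, contDiff_iff_contDiffAt.2 fun u => ?_, fun u => ?_, ?_,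
    fun u => ?_, fun u hεu huR => ?_⟩
  · simp [hK', hK.odd u]
  · rw [hK', inner_smul_right, hK.inner_self, mul_zero]
  · rcases eq_or_ne u 0 with rfl | hu
    · exact contDiffAt_const.congr_of_eventuallyEq hzero
    · exact (hχ.comp (contDiff_norm_sq ℝ)).contDiffAt.smul (hK.contDiffAt hu)
  · rcases eq_or_ne u 0 with rfl | hu
    · rw [hzero.fderiv_eq]
      simp
    · rw [trace_fderiv_comp_norm_sq_smul ((hχ.differentiable (by simp)) _)
        ((hK.contDiffAt hu).differentiableAt (by simp)) (hK.inner_self u), hK.trace_fderiv u hu,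
        mul_zero]
  · refine HasCompactSupport.intro (isCompact_closedBall 0 (R + ε)) fun u hu => ?_
    have hfar : R + ε < ‖u‖ := by simpa using hu
    rw [hK', hχ_far _ (by nlinarith [norm_nonneg u]), zero_smul]
  · rw [hK', norm_smul, Real.norm_of_nonneg (hχ01 _).1]
    exact mul_le_of_le_one_left (norm_nonneg _) (hχ01 _).2
  · rw [hK', hχ1 _ ⟨by gcongr, by gcongr⟩, one_smul]

end Kernel

section CollisionWeight

section Weight

variable {E : Type*} [NormedAddCommGroup E] {q : ℝ}

/-- The singular weight `1 + |u|^{-q}`, infinite at the origin, that dominates the interaction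
kernel at the separation `u` of two points. -/
def collisionWeight (q : ℝ) (u : E) : ℝ≥0∞ := 1 + ‖u‖ₑ ^ (-q)

lemma collisionWeight_sub_comm (q : ℝ) (u v : E) :
    collisionWeight q (u - v) = collisionWeight q (v - u) := by
  rw [collisionWeight, enorm_sub_rev, collisionWeight]

lemma collisionWeight_zero (hq : 0 < q) : collisionWeight q (0 : E) = ⊤ := by
  simp [collisionWeight, hq]

lemma collisionWeight_of_ne_zero (q : ℝ) {u : E} (hu : u ≠ 0) :
    collisionWeight q u = ENNReal.ofReal (1 + ‖u‖ ^ (-q)) := by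
  rw [collisionWeight, ENNReal.ofReal_add zero_le_one (by positivity), ENNReal.ofReal_one,
    ← ofReal_norm, ENNReal.ofReal_rpow_of_pos (norm_pos_iff.2 hu)]

lemma ofReal_le_collisionWeight (hq : 0 < q) {u : E} {r : ℝ}
    (hr : u ≠ 0 → r ≤ 1 + ‖u‖ ^ (-q)) : ENNReal.ofReal r ≤ collisionWeight q u := by
  rcases eq_or_ne u 0 with rfl | hu
  · rw [collisionWeight_zero hq]
    exact le_top
  · rw [collisionWeight_of_ne_zero q hu]
    exact ENNReal.ofReal_le_ofReal (hr hu)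

lemma collisionWeight_le_two (hq : 0 < q) {u : E} (hu : 1 ≤ ‖u‖) : collisionWeight q u ≤ 2 := by
  rw [collisionWeight_of_ne_zero q (norm_pos_iff.1 (by linarith)), ← ENNReal.ofReal_ofNat]
  refine ENNReal.ofReal_le_ofReal ?_
  linarith [Real.rpow_le_one_of_one_le_of_nonpos hu (neg_nonpos.2 hq.le)]

variable [MeasurableSpace E] [BorelSpace E]

@[fun_prop]
lemma measurable_collisionWeight (q : ℝ) : Measurable (collisionWeight q : E → ℝ≥0∞) :=
  (measurable_enorm.pow_const _).const_add _

variable [NormedSpace ℝ E] [FiniteDimensional ℝ E] (μ : Measure E) [μ.IsAddHaarMeasure]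

lemma setLIntegral_collisionWeight_ball_lt_top (hq : 0 < q) (hqd : q < Module.finrank ℝ E)
    (R : ℝ) : ∫⁻ u in Metric.ball 0 R, collisionWeight q u ∂μ < ⊤ := by
  have hdim : 1 ≤ Module.finrank ℝ E := by exact_mod_cast hq.trans hqd
  have : Nontrivial E := Module.nontrivial_of_finrank_pos hdim
  have hloc : LocallyIntegrable (fun u : E => ‖u‖ ^ (-q)) μ :=
    locallyIntegrable_of_norm_le_rpow hdim (C := 1) hqd
      (ae_of_all _ fun u => by rw [Real.norm_of_nonneg (by positivity), one_mul])
      (measurable_norm.pow_const _).aestronglyMeasurable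
  have hint : IntegrableOn (fun u : E => 1 + ‖u‖ ^ (-q)) (Metric.ball 0 R) μ :=
    (((locallyIntegrable_const 1).add hloc).integrableOn_isCompact
      (isCompact_closedBall 0 R)).mono_set Metric.ball_subset_closedBall
  have hne : ∀ᵐ u ∂μ.restrict (Metric.ball 0 R), u ≠ 0 :=
    ae_restrict_of_ae (by simp [ae_iff])
  rw [lintegral_congr_ae (hne.mono fun u hu => collisionWeight_of_ne_zero q hu)]
  exact hint.lintegral_lt_top

lemma exists_setLIntegral_collisionWeight_sub_le (hq : 0 < q) (hqd : q < Module.finrank ℝ E)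
    (R : ℝ) : ∃ C : ℝ≥0∞, C ≠ ⊤ ∧
      ∀ z, ∫⁻ y in Metric.ball 0 R, collisionWeight q (z - y) ∂μ ≤ C := by
  set w : E → ℝ≥0∞ := (Metric.ball 0 1).indicator (collisionWeight q)
  have hle : ∀ u : E, collisionWeight q u ≤ w u + 2 := by
    intro u
    by_cases hu : u ∈ Metric.ball 0 1
    · simp only [w, indicator_of_mem hu, le_self_add]
    · exact (collisionWeight_le_two hq (by simpa using hu)).trans le_add_self
  refine ⟨∫⁻ u, w u ∂μ + 2 * μ (Metric.ball 0 R), ENNReal.add_ne_top.2 ⟨?_, ?_⟩, fun z => ?_⟩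
  · rw [lintegral_indicator measurableSet_ball]
    exact (setLIntegral_collisionWeight_ball_lt_top μ hq hqd 1).ne
  · exact ENNReal.mul_ne_top (by simp) measure_ball_lt_top.ne
  · calc ∫⁻ y in Metric.ball 0 R, collisionWeight q (z - y) ∂μ
        ≤ ∫⁻ y in Metric.ball 0 R, (w (z - y) + 2) ∂μ := lintegral_mono fun y => hle _
      _ = ∫⁻ y in Metric.ball 0 R, w (z - y) ∂μ + 2 * μ (Metric.ball 0 R) := by
          rw [lintegral_add_right _ measurable_const, setLIntegral_const]
      _ ≤ ∫⁻ y, w (z - y) ∂μ + 2 * μ (Metric.ball 0 R) := by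
          gcongr ?_ + _
          exact setLIntegral_le_lintegral _ _
      _ = ∫⁻ u, w u ∂μ + 2 * μ (Metric.ball 0 R) := by rw [lintegral_sub_left_eq_self w z]

end Weight

section Marginal

variable {ι E : Type*} [Fintype ι] [DecidableEq ι] [AddCommGroup E] [MeasurableSpace E]
  [MeasurableSub₂ E] {μ : Measure E} [IsFiniteMeasure μ] {w : E → ℝ≥0∞} {C : ℝ≥0∞}
  {i k : ι}

/-- Integrating out the `k`-th point, on which `G` does not depend, bounds the factor `w`. -/
lemma measure_univ_mul_lintegral_mul_comp_sub_le (hw : Measurable w)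
    (hC : ∀ z, ∫⁻ y, w (z - y) ∂μ ≤ C) {G : (ι → E) → ℝ≥0∞} (hG : Measurable G) (hik : i ≠ k)
    (hGk : ∀ x y, G (Function.update x k y) = G x) :
    μ univ * ∫⁻ x, G x * w (x i - x k) ∂Measure.pi (fun _ => μ) ≤
      C * ∫⁻ x, G x ∂Measure.pi (fun _ => μ) := by
  have hGw : Measurable fun x : ι → E => G x * w (x i - x k) := by fun_prop
  rw [← lintegral_const_mul _ hGw, ← lintegral_const_mul _ hG]
  refine lintegral_le_of_lmarginal_le (μ := fun _ => μ) {k} (hGw.const_mul _)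
    (hG.const_mul _) ?_
  rw [lmarginal_singleton, lmarginal_singleton]
  intro x
  have hwx : Measurable fun y => w (x i - y) := by fun_prop
  simp only [hGk, Function.update_of_ne hik, Function.update_self, lintegral_const]
  rw [lintegral_const_mul' _ _ (measure_ne_top μ univ), lintegral_const_mul _ hwx]
  calc μ univ * (G x * ∫⁻ y, w (x i - y) ∂μ) ≤ μ univ * (G x * C) := by gcongr; exact hC _
    _ = C * G x * μ univ := by ring

end Marginal

section Majorant

variable {ι E : Type*} [Fintype ι] [DecidableEq ι] [NormedAddCommGroup E] {q R : ℝ}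

/-- The total singular weight of the pairs of a configuration. -/
def pairMajorant (q : ℝ) (x : ι → E) : ℝ≥0∞ :=
  ∑ i, ∑ j ∈ Finset.univ.erase i, collisionWeight q (x i - x j)

/-- The total singular weight of the triples of a configuration: the distance of a pair `i, j` is
changed by the difference of the velocities that a third point `k` induces at its two members. -/
def tripleMajorant (q : ℝ) (x : ι → E) : ℝ≥0∞ :=
  ∑ i, ∑ j ∈ Finset.univ.erase i, ∑ k ∈ (Finset.univ.erase i).erase j,
    collisionWeight q (x i - x j) *
      (collisionWeight q (x i - x k) + collisionWeight q (x j - x k))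

variable [NormedSpace ℝ E] [FiniteDimensional ℝ E] [MeasureSpace E] [BorelSpace E]
  [(volume : Measure E).IsAddHaarMeasure]

lemma setLIntegral_mul_collisionWeight_lt_top (hq : 0 < q) (hqd : q < Module.finrank ℝ E)
    (hR : 0 < R) {G : (ι → E) → ℝ≥0∞} (hG : Measurable G) {i k : ι} (hik : i ≠ k)
    (hGk : ∀ x y, G (Function.update x k y) = G x)
    (hG_fin : ∫⁻ x in Metric.ball 0 R, G x < ⊤) :
    ∫⁻ x in Metric.ball 0 R, G x * collisionWeight q (x i - x k) < ⊤ := by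
  set μ : Measure E := volume.restrict (Metric.ball 0 R)
  have hball : (volume : Measure (ι → E)).restrict (Metric.ball 0 R) = Measure.pi fun _ => μ := by
    rw [ball_pi _ hR, volume_pi, Measure.restrict_pi_pi]
    rfl
  have : IsFiniteMeasure μ := isFiniteMeasure_restrict.2 measure_ball_lt_top.ne
  obtain ⟨C, hC, hwC⟩ := exists_setLIntegral_collisionWeight_sub_le (volume : Measure E) hq hqd R
  rw [hball] at hG_fin ⊢
  refine ENNReal.lt_top_of_mul_ne_top_right
    ((measure_univ_mul_lintegral_mul_comp_sub_le (measurable_collisionWeight q) hwC hG hik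
      hGk).trans_lt (ENNReal.mul_lt_top hC.lt_top hG_fin)).ne ?_
  rw [Measure.restrict_apply_univ]
  exact (Metric.measure_ball_pos volume 0 hR).ne'

omit [DecidableEq ι] in
lemma setLIntegral_collisionWeight_lt_top (hq : 0 < q) (hqd : q < Module.finrank ℝ E)
    (hR : 0 < R) {i j : ι} (hij : i ≠ j) :
    ∫⁻ x in Metric.ball (0 : ι → E) R, collisionWeight q (x i - x j) < ⊤ := by
  classical
  simpa only [one_mul] using setLIntegral_mul_collisionWeight_lt_top hq hqd hR
    (G := fun _ => 1) measurable_const hij (fun _ _ => rfl)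
    (by rw [setLIntegral_one]; exact measure_ball_lt_top)

omit [DecidableEq ι] in
lemma setLIntegral_collisionWeight_mul_collisionWeight_lt_top (hq : 0 < q)
    (hqd : q < Module.finrank ℝ E) (hR : 0 < R) {i j k : ι} (hij : i ≠ j) (hik : i ≠ k)
    (hjk : j ≠ k) :
    ∫⁻ x in Metric.ball (0 : ι → E) R,
      collisionWeight q (x i - x j) * collisionWeight q (x i - x k) < ⊤ := by
  classical
  exact setLIntegral_mul_collisionWeight_lt_top hq hqd hR (by fun_prop) hik
    (fun x y => by rw [Function.update_of_ne hik, Function.update_of_ne hjk])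
    (setLIntegral_collisionWeight_lt_top hq hqd hR hij)

lemma setLIntegral_pairMajorant_lt_top (hq : 0 < q) (hqd : q < Module.finrank ℝ E) (hR : 0 < R) :
    ∫⁻ x in Metric.ball (0 : ι → E) R, pairMajorant q x < ⊤ := by
  simp only [pairMajorant]
  rw [lintegral_finsetSum _ (by fun_prop)]
  refine ENNReal.sum_lt_top.2 fun i _ => ?_
  rw [lintegral_finsetSum _ (by fun_prop)]
  exact ENNReal.sum_lt_top.2 fun j hj =>
    setLIntegral_collisionWeight_lt_top hq hqd hR (Finset.ne_of_mem_erase hj).symm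

lemma setLIntegral_tripleMajorant_lt_top (hq : 0 < q) (hqd : q < Module.finrank ℝ E)
    (hR : 0 < R) : ∫⁻ x in Metric.ball (0 : ι → E) R, tripleMajorant q x < ⊤ := by
  simp only [tripleMajorant]
  rw [lintegral_finsetSum _ (by fun_prop)]
  refine ENNReal.sum_lt_top.2 fun i _ => ?_
  rw [lintegral_finsetSum _ (by fun_prop)]
  refine ENNReal.sum_lt_top.2 fun j hj => ?_
  rw [lintegral_finsetSum _ (by fun_prop)]
  refine ENNReal.sum_lt_top.2 fun k hk => ?_
  have hij : i ≠ j := (Finset.ne_of_mem_erase hj).symm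
  have hjk : j ≠ k := (Finset.ne_of_mem_erase hk).symm
  have hik : i ≠ k := (Finset.ne_of_mem_erase (Finset.mem_of_mem_erase hk)).symm
  simp only [mul_add]
  rw [lintegral_add_left (by fun_prop)]
  refine ENNReal.add_lt_top.2
    ⟨setLIntegral_collisionWeight_mul_collisionWeight_lt_top hq hqd hR hij hik hjk, ?_⟩
  rw [lintegral_congr fun x : ι → E => by rw [collisionWeight_sub_comm q (x i)]]
  exact setLIntegral_collisionWeight_mul_collisionWeight_lt_top hq hqd hR hij.symm hjk hik

end Majorant

end CollisionWeight

section MaximalInequality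

lemma exists_isFlowOn_closedBall {E : Type*} [NormedAddCommGroup E] [NormedSpace ℝ E]
    [CompleteSpace E] {V : E → E} {L : ℝ≥0} (hL : LipschitzWith L V) {M : ℝ}
    (hM : ∀ x, ‖V x‖ ≤ M) {R T : ℝ} (hR : 0 ≤ R) (hT : 0 ≤ T) :
    ∃ X : E → ℝ → E, IsFlowOn V (Metric.closedBall 0 R) T X ∧
      ContinuousOn ↿X (Metric.closedBall 0 R ×ˢ Icc 0 T) := by
  have hM0 : 0 ≤ M := (norm_nonneg _).trans (hM 0)
  have hPL : IsPicardLindelof (fun _ : ℝ => V) (tmin := 0) (tmax := T) ⟨0, le_rfl, hT⟩ (0 : E)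
      (R.toNNReal + M.toNNReal * T.toNNReal) R.toNNReal M.toNNReal L := by
    refine .of_time_independent (fun x _ => ?_) hL.lipschitzOnWith ?_
    · rw [Real.coe_toNNReal _ hM0]
      exact hM x
    · simp [hT, hM0, hR]
  obtain ⟨X, hX, hXc⟩ := hPL.exists_forall_mem_closedBall_eq_hasDerivWithinAt_continuousOn
  rw [Real.coe_toNNReal _ hR] at hX hXc
  exact ⟨fun x t => X (x, t), ⟨fun x hx => (hX x hx).1, fun x hx => (hX x hx).2⟩, hXc⟩

lemma IsFlowOn.mono {E : Type*} [NormedAddCommGroup E] [NormedSpace ℝ E] {V : E → E}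
    {S S' : Set E} {T T' : ℝ} {X : E → ℝ → E} (hX : IsFlowOn V S T X) (hS : S' ⊆ S)
    (hT : T' ≤ T) : IsFlowOn V S' T' X where
  initial x hx := hX.initial x (hS hx)
  motion x hx τ hτ := (hX.motion x (hS hx) τ ⟨hτ.1, hτ.2.trans hT⟩).mono
    (Icc_subset_Icc_right hT)

lemma ofReal_le_add_lintegral_enorm_deriv {f f' : ℝ → ℝ} {T t : ℝ} (ht : t ∈ Icc 0 T)
    (hf : ∀ τ ∈ Icc 0 T, HasDerivWithinAt f (f' τ) (Icc 0 T) τ)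
    (hf' : ContinuousOn f' (Icc 0 T)) :
    ENNReal.ofReal (f t) ≤ ENNReal.ofReal (f 0) + ∫⁻ τ in Icc 0 T, ‖f' τ‖ₑ := by
  have hsub : Icc 0 t ⊆ Icc 0 T := Icc_subset_Icc_right ht.2
  have hftc : ∫ τ in (0 : ℝ)..t, f' τ = f t - f 0 :=
    intervalIntegral.integral_eq_sub_of_hasDerivAt_of_le ht.1
      ((HasDerivWithinAt.continuousOn hf).mono hsub)
      (fun τ hτ => (hf τ (hsub (Ioo_subset_Icc_self hτ))).hasDerivAt
        (Icc_mem_nhds hτ.1 (hτ.2.trans_le ht.2)))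
      ((hf'.mono hsub).intervalIntegrable_of_Icc ht.1)
  calc ENNReal.ofReal (f t) = ENNReal.ofReal (f 0 + ∫ τ in Ioc 0 t, f' τ) := by
        rw [← intervalIntegral.integral_of_le ht.1, hftc, add_sub_cancel]
    _ ≤ ENNReal.ofReal (f 0) + ENNReal.ofReal ‖∫ τ in Ioc 0 t, f' τ‖ :=
        ENNReal.ofReal_add_le.trans (by gcongr; exact Real.le_norm_self _)
    _ ≤ ENNReal.ofReal (f 0) + ∫⁻ τ in Ioc 0 t, ‖f' τ‖ₑ := by
        rw [ofReal_norm]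
        gcongr
        exact enorm_integral_le_lintegral_enorm _
    _ ≤ ENNReal.ofReal (f 0) + ∫⁻ τ in Icc 0 T, ‖f' τ‖ₑ := by
        gcongr
        exact Ioc_subset_Icc_self.trans hsub

variable {E : Type*} [NormedAddCommGroup E] [NormedSpace ℝ E] {V : E → E} {S U : Set E} {T : ℝ}
  {X : E → ℝ → E}

lemma IsFlowOn.ofReal_comp_le (hX : IsFlowOn V S T X) (hVc : Continuous V) {f : E → ℝ}
    (hf : ContDiff ℝ 1 f) {x : E} (hx : x ∈ S) {t : ℝ} (ht : t ∈ Icc 0 T) :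
    ENNReal.ofReal (f (X x t)) ≤
      ENNReal.ofReal (f x) + ∫⁻ τ in Icc 0 T, ‖fderiv ℝ f (X x τ) (V (X x τ))‖ₑ := by
  have h := ofReal_le_add_lintegral_enorm_deriv (f := fun τ => f (X x τ)) ht
    (fun τ hτ => ((hf.differentiable one_ne_zero) _).hasFDerivAt.comp_hasDerivWithinAt τ
      (hX.motion x hx τ hτ))
    (((hf.continuous_fderiv one_ne_zero).clm_apply hVc).comp_continuousOn
      (HasDerivWithinAt.continuousOn (hX.motion x hx)))
  rwa [hX.initial x hx] at h

variable [FiniteDimensional ℝ E] [MeasurableSpace E] [BorelSpace E] {μ : Measure E}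
  [μ.IsAddHaarMeasure]

/-- A maximal inequality for incompressible flows: volume preservation turns the integral over
time of the variation of `f` along the orbits into an integral over space. -/
theorem IsIncompressibleField.mul_measure_le_of_forall_exists_le (hV : IsIncompressibleField V)
    (hS : MeasurableSet S) (hU : IsOpen U) (hX : IsFlowOn V S T X)
    (hXc : ContinuousOn ↿X (S ×ˢ Icc 0 T)) (hXU : ∀ x ∈ S, ∀ t ∈ Icc 0 T, X x t ∈ U) {f : E → ℝ}
    (hf : ContDiff ℝ 1 f) {a : ℝ} {A : Set E} (hAS : A ⊆ S)
    (hA : ∀ x ∈ A, ∃ t ∈ Icc 0 T, a ≤ f (X x t)) :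
    ENNReal.ofReal a * μ A ≤ (∫⁻ x in S, ENNReal.ofReal (f x) ∂μ) +
      ENNReal.ofReal T * ∫⁻ x in U, ‖fderiv ℝ f x (V x)‖ₑ ∂μ := by
  have hVc : Continuous V := hV.differentiable.continuous
  set w : E → ℝ≥0∞ := fun x => ‖fderiv ℝ f x (V x)‖ₑ
  have hw : Continuous w := ((hf.continuous_fderiv one_ne_zero).clm_apply hVc).enorm
  have hwX : AEMeasurable (Function.uncurry fun x τ => w (X x τ))
      ((μ.restrict S).prod (volume.restrict (Icc 0 T))) := by
    rw [Measure.prod_restrict]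
    exact (hw.comp_continuousOn hXc).aemeasurable (hS.prod measurableSet_Icc)
  have hf0 : Measurable fun x => ENNReal.ofReal (f x) := by
    have := hf.continuous.measurable
    fun_prop
  calc ENNReal.ofReal a * μ A
      ≤ ENNReal.ofReal a * μ.restrict S
          {x | ENNReal.ofReal a ≤ ENNReal.ofReal (f x) + ∫⁻ τ in Icc 0 T, w (X x τ)} := by
        rw [Measure.restrict_apply' hS]
        gcongr
        refine fun x hx => ⟨?_, hAS hx⟩
        obtain ⟨t, ht, hat⟩ := hA x hx
        exact (ENNReal.ofReal_le_ofReal hat).trans (hX.ofReal_comp_le hVc hf (hAS hx) ht)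
    _ ≤ ∫⁻ x in S, (ENNReal.ofReal (f x) + ∫⁻ τ in Icc 0 T, w (X x τ)) ∂μ :=
        mul_meas_ge_le_lintegral₀ (hf0.aemeasurable.add hwX.lintegral_prod_right') _
    _ = (∫⁻ x in S, ENNReal.ofReal (f x) ∂μ) + ∫⁻ τ in Icc 0 T, ∫⁻ x in S, w (X x τ) ∂μ := by
        rw [lintegral_add_left hf0, lintegral_lintegral_swap hwX]
    _ ≤ (∫⁻ x in S, ENNReal.ofReal (f x) ∂μ) + ∫⁻ _ in Icc 0 T, ∫⁻ x in U, w x ∂μ := by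
        refine add_le_add le_rfl (setLIntegral_mono' measurableSet_Icc fun τ hτ => ?_)
        exact hV.lintegral_comp_flow_le hS hU hτ.1 (hX.mono subset_rfl hτ.2)
            (fun x hx => hXU x hx τ hτ) hw.lowerSemicontinuous
    _ = _ := by rw [setLIntegral_const, Real.volume_Icc, sub_zero, mul_comm (∫⁻ x in U, w x ∂μ)]

end MaximalInequality

section InteractionEnergy

section Softening

variable {E : Type*} [NormedAddCommGroup E] {a : ℝ}

lemma norm_sq_rpow_div_two (a : ℝ) (u : E) : (‖u‖ ^ 2) ^ (a / 2) = ‖u‖ ^ a := by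
  rw [← Real.rpow_natCast_mul (norm_nonneg u), Nat.cast_ofNat, mul_div_cancel₀ a two_ne_zero]

lemma norm_sq_add_sq_rpow_le (ha : a ≤ 0) (ε : ℝ) {u : E} (hu : u ≠ 0) :
    (‖u‖ ^ 2 + ε ^ 2) ^ (a / 2) ≤ ‖u‖ ^ a := by
  rw [← norm_sq_rpow_div_two]
  exact Real.rpow_le_rpow_of_nonpos (by positivity) (by simp [sq_nonneg]) (by linarith)

end Softening

variable {ι E : Type*} [Fintype ι] [DecidableEq ι] [NormedAddCommGroup E] {q ε : ℝ}

/-- The sum of the powers `|x i - x j|^{1 - q}` over all pairs, softened at the scale `ε` so that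
it is smooth. For `1 < q` it is large when two of the points are close. -/
def interactionEnergy (q ε : ℝ) (x : ι → E) : ℝ :=
  ∑ i, ∑ j ∈ Finset.univ.erase i, (‖x i - x j‖ ^ 2 + ε ^ 2) ^ ((1 - q) / 2)

lemma le_interactionEnergy (hq : 1 ≤ q) (hε : 0 < ε) {x : ι → E} {i j : ι} (hij : i ≠ j)
    (hx : ‖x i - x j‖ ≤ ε) : (2 * ε ^ 2) ^ ((1 - q) / 2) ≤ interactionEnergy q ε x := by
  have hnonneg : ∀ i j, 0 ≤ (‖x i - x j‖ ^ 2 + ε ^ 2) ^ ((1 - q) / 2) := fun i j => by positivity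
  calc (2 * ε ^ 2) ^ ((1 - q) / 2) ≤ (‖x i - x j‖ ^ 2 + ε ^ 2) ^ ((1 - q) / 2) := by
        refine Real.rpow_le_rpow_of_nonpos (by positivity) ?_ (by linarith)
        rw [two_mul]
        gcongr
    _ ≤ ∑ j ∈ Finset.univ.erase i, (‖x i - x j‖ ^ 2 + ε ^ 2) ^ ((1 - q) / 2) :=
        Finset.single_le_sum (f := fun j => (‖x i - x j‖ ^ 2 + ε ^ 2) ^ ((1 - q) / 2))
          (fun j _ => hnonneg i j) (Finset.mem_erase.2 ⟨hij.symm, Finset.mem_univ j⟩)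
    _ ≤ interactionEnergy q ε x :=
        Finset.single_le_sum (f := fun i => ∑ j ∈ Finset.univ.erase i, _)
          (fun i _ => Finset.sum_nonneg fun j _ => hnonneg i j) (Finset.mem_univ i)

lemma ofReal_interactionEnergy_le (hq : 1 ≤ q) (ε : ℝ) (x : ι → E) :
    ENNReal.ofReal (interactionEnergy q ε x) ≤ pairMajorant q x := by
  have hsoft : ∀ u : E, u ≠ 0 → (‖u‖ ^ 2 + ε ^ 2) ^ ((1 - q) / 2) ≤ 1 + ‖u‖ ^ (-q) := by
    intro u hu
    refine (norm_sq_add_sq_rpow_le (by linarith) ε hu).trans ?_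
    rcases le_total 1 ‖u‖ with h | h
    · linarith [Real.rpow_le_one_of_one_le_of_nonpos h (show 1 - q ≤ 0 by linarith),
        Real.rpow_nonneg (norm_nonneg u) (-q)]
    · linarith [Real.rpow_le_rpow_of_exponent_ge (norm_pos_iff.2 hu) h
        (show -q ≤ 1 - q by linarith)]
  rw [interactionEnergy, pairMajorant, ENNReal.ofReal_sum_of_nonneg fun i _ => by positivity]
  gcongr with i
  rw [ENNReal.ofReal_sum_of_nonneg fun j _ => by positivity]
  gcongr with j
  exact ofReal_le_collisionWeight (by linarith) fun hu => hsoft _ hu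

variable [InnerProductSpace ℝ E] {γ : ι → ℝ} {K : E → E}

lemma contDiff_interactionEnergy (q : ℝ) (hε : ε ≠ 0) :
    ContDiff ℝ 1 (interactionEnergy q ε : (ι → E) → ℝ) := by
  refine ContDiff.sum fun i _ => ContDiff.sum fun j _ => ContDiff.rpow_const_of_ne ?_ fun x => ?_
  · exact (((contDiff_apply ℝ E i).sub (contDiff_apply ℝ E j)).norm_sq ℝ).add contDiff_const
  · positivity

lemma fderiv_interactionEnergy_apply (q : ℝ) (hε : ε ≠ 0) (x v : ι → E) :
    fderiv ℝ (interactionEnergy q ε) x v = ∑ i, ∑ j ∈ Finset.univ.erase i,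
      (1 - q) * (‖x i - x j‖ ^ 2 + ε ^ 2) ^ ((-1 - q) / 2) * inner ℝ (x i - x j) (v i - v j) := by
  have hpair : ∀ i j, HasFDerivAt (fun y : ι → E => ‖y i - y j‖ ^ 2 + ε ^ 2)
      (2 • (innerSL ℝ (x i - x j)).comp (.proj i - .proj j)) x := fun i j =>
    (((hasFDerivAt_apply i x).sub (hasFDerivAt_apply j x)).norm_sq).add_const (ε ^ 2)
  have hsum := HasFDerivAt.fun_sum fun i (_ : i ∈ Finset.univ) =>
    HasFDerivAt.fun_sum fun j (_ : j ∈ Finset.univ.erase i) =>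
      (hpair i j).rpow_const (p := (1 - q) / 2) (Or.inl (by positivity))
  rw [show fderiv ℝ (interactionEnergy q ε) x = _ from hsum.fderiv]
  simp only [sum_apply, show (1 - q) / 2 - 1 = (-1 - q) / 2 by ring]
  refine Finset.sum_congr rfl fun i _ => Finset.sum_congr rfl fun j _ => ?_
  simp only [smul_apply, ContinuousLinearMap.comp_apply, sub_apply, ContinuousLinearMap.proj_apply,
    coe_innerSL_apply, nsmul_eq_mul, Nat.cast_ofNat, smul_eq_mul]
  ring

/-- The velocities that two points induce on each other are orthogonal to their separation. -/
lemma inner_vortexField_sub_vortexField (hK : K.Odd) (hinner : ∀ u, inner ℝ u (K u) = 0)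
    (x : ι → E) {i j : ι} (hij : i ≠ j) :
    inner ℝ (x i - x j) (vortexField γ K Finset.univ x i - vortexField γ K Finset.univ x j) =
      inner ℝ (x i - x j)
        (∑ k ∈ (Finset.univ.erase i).erase j, γ k • (K (x i - x k) - K (x j - x k))) := by
  have hi : vortexField γ K Finset.univ x i = γ j • K (x i - x j) +
      ∑ k ∈ (Finset.univ.erase i).erase j, γ k • K (x i - x k) :=
    (Finset.add_sum_erase _ _ (by simp [hij.symm])).symm
  have hj : vortexField γ K Finset.univ x j = -(γ i • K (x i - x j)) +
      ∑ k ∈ (Finset.univ.erase i).erase j, γ k • K (x j - x k) := by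
    rw [← smul_neg, ← hK, neg_sub, Finset.erase_right_comm]
    exact (Finset.add_sum_erase _ _ (by simp [hij])).symm
  rw [hi, hj]
  simp only [smul_sub, Finset.sum_sub_distrib, inner_sub_right, inner_add_right, inner_neg_right,
    inner_smul_right, hinner]
  ring

lemma enorm_rpow_mul_inner_le (hq : 0 < q) (ε : ℝ) (u v : E) :
    ‖(‖u‖ ^ 2 + ε ^ 2) ^ ((-1 - q) / 2) * inner ℝ u v‖ₑ ≤ collisionWeight q u * ‖v‖ₑ := by
  have hsoft : u ≠ 0 → (‖u‖ ^ 2 + ε ^ 2) ^ ((-1 - q) / 2) * ‖u‖ ≤ 1 + ‖u‖ ^ (-q) := fun hu =>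
    calc (‖u‖ ^ 2 + ε ^ 2) ^ ((-1 - q) / 2) * ‖u‖ ≤ ‖u‖ ^ (-1 - q) * ‖u‖ := by
          gcongr
          exact norm_sq_add_sq_rpow_le (by linarith) ε hu
      _ = ‖u‖ ^ (-q) := by
          rw [← Real.rpow_add_one (norm_ne_zero_iff.2 hu)]
          ring_nf
      _ ≤ 1 + ‖u‖ ^ (-q) := by linarith
  calc ‖(‖u‖ ^ 2 + ε ^ 2) ^ ((-1 - q) / 2) * inner ℝ u v‖ₑ
      = ENNReal.ofReal ((‖u‖ ^ 2 + ε ^ 2) ^ ((-1 - q) / 2) * |inner ℝ u v|) := by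
        rw [← ofReal_norm, norm_mul, Real.norm_of_nonneg (by positivity), Real.norm_eq_abs]
    _ ≤ ENNReal.ofReal ((‖u‖ ^ 2 + ε ^ 2) ^ ((-1 - q) / 2) * ‖u‖ * ‖v‖) := by
        rw [mul_assoc]
        gcongr
        exact abs_real_inner_le_norm u v
    _ ≤ collisionWeight q u * ‖v‖ₑ := by
        rw [ENNReal.ofReal_mul (by positivity), ofReal_norm]
        gcongr
        exact ofReal_le_collisionWeight hq hsoft

omit [DecidableEq ι] in
lemma enorm_sum_smul_sub_le {C : ℝ≥0∞} (hKC : ∀ u, ‖K u‖ₑ ≤ C * collisionWeight q u)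
    (J : Finset ι) (x : ι → E) (i j : ι) :
    ‖∑ k ∈ J, γ k • (K (x i - x k) - K (x j - x k))‖ₑ ≤ ENNReal.ofReal (absCirculation γ) * C *
      ∑ k ∈ J, (collisionWeight q (x i - x k) + collisionWeight q (x j - x k)) := by
  refine (enorm_sum_le _ _).trans ?_
  rw [Finset.mul_sum]
  gcongr with k
  have hγk : ‖γ k‖ₑ ≤ ENNReal.ofReal (absCirculation γ) := by
    rw [← ofReal_norm, Real.norm_eq_abs]
    exact ENNReal.ofReal_le_ofReal
      (Finset.single_le_sum (fun l _ => abs_nonneg (γ l)) (Finset.mem_univ k))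
  rw [enorm_smul, mul_assoc, mul_add]
  gcongr
  exact enorm_sub_le.trans (add_le_add (hKC _) (hKC _))

/-- The rate of change of the energy along the flow involves only triples of distinct points. This
is why it is no more singular than an integrable function, uniformly in `ε`. -/
theorem enorm_fderiv_interactionEnergy_le (hq : 0 < q) (hε : ε ≠ 0) (hK : K.Odd)
    (hinner : ∀ u, inner ℝ u (K u) = 0) {C : ℝ≥0∞} (hKC : ∀ u, ‖K u‖ₑ ≤ C * collisionWeight q u)
    (x : ι → E) :
    ‖fderiv ℝ (interactionEnergy q ε) x (vortexField γ K Finset.univ x)‖ₑ ≤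
      ‖1 - q‖ₑ * (ENNReal.ofReal (absCirculation γ) * C) * tripleMajorant q x := by
  rw [fderiv_interactionEnergy_apply q hε, tripleMajorant]
  refine (enorm_sum_le _ _).trans ?_
  rw [Finset.mul_sum]
  gcongr with i
  refine (enorm_sum_le _ _).trans ?_
  rw [Finset.mul_sum]
  gcongr with j hj
  rw [inner_vortexField_sub_vortexField hK hinner x (Finset.ne_of_mem_erase hj).symm, mul_assoc,
    enorm_mul, mul_assoc, ← Finset.mul_sum, mul_left_comm _ (collisionWeight q _)]
  gcongr
  refine (enorm_rpow_mul_inner_le hq ε _ _).trans ?_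
  gcongr
  exact enorm_sum_smul_sub_le hKC _ x i j

end InteractionEnergy

section SeparatedSolution

variable {ι E : Type*} [Fintype ι] [DecidableEq ι] [NormedAddCommGroup E] {x : ι → E}
  {Y Z : ℝ → ι → E} {γ : ι → ℝ} {K K' : E → E} {T δ L : ℝ}

/-- `Y` solves the vortex system with initial configuration `x` on `[0, T]`, and all mutual
distances stay between `δ` and `L`. -/
structure IsSeparatedSolution [NormedSpace ℝ E] (γ : ι → ℝ) (K : E → E) (T δ L : ℝ) (x : ι → E)
    (Y : ℝ → ι → E) : Prop where
  initial : Y 0 = x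
  motion : ∀ τ ∈ Icc 0 T, HasDerivWithinAt Y (vortexField γ K Finset.univ (Y τ)) (Icc 0 T) τ
  separated : ∀ τ ∈ Icc 0 T, ∀ i j, i ≠ j → ‖Y τ i - Y τ j‖ ∈ Icc δ L

/-- `X` solves the vortex system with initial configuration `x` for all nonnegative times, is smooth
up to the initial time, and never has a collision. -/
structure IsGlobalCollisionlessSolution [NormedSpace ℝ E] (γ : ι → ℝ) (K : E → E) (x : ι → E)
    (X : ℝ → ι → E) : Prop where
  initial : X 0 = x
  motion : ∀ t, 0 ≤ t → HasDerivWithinAt X (vortexField γ K Finset.univ (X t)) (Ici 0) t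
  contDiffOn : ContDiffOn ℝ ∞ X (Ici 0)
  injective : ∀ t, 0 ≤ t → Function.Injective (X t)

lemma IsTruncation.vortexField_eq [InnerProductSpace ℝ E] {ε R : ℝ} (hK' : IsTruncation K ε R K')
    (hx : ∀ i j, i ≠ j → ‖x i - x j‖ ∈ Icc ε R) :
    vortexField γ K' Finset.univ x = vortexField γ K Finset.univ x := by
  funext j
  refine Finset.sum_congr rfl fun k hk => ?_
  have h := hx j k (Finset.ne_of_mem_erase hk).symm
  rw [hK'.eq_self _ h.1 h.2]

namespace IsSeparatedSolution

section NormedSpace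

variable [NormedSpace ℝ E]

lemma mono (hY : IsSeparatedSolution γ K T δ L x Y) {T' δ' L' : ℝ} (hT : T' ≤ T) (hδ : δ' ≤ δ)
    (hL : L ≤ L') : IsSeparatedSolution γ K T' δ' L' x Y where
  initial := hY.initial
  motion τ hτ := (hY.motion τ ⟨hτ.1, hτ.2.trans hT⟩).mono (Icc_subset_Icc_right hT)
  separated τ hτ i j hij := Icc_subset_Icc hδ hL (hY.separated τ ⟨hτ.1, hτ.2.trans hT⟩ i j hij)

lemma congr (hY : IsSeparatedSolution γ K T δ L x Y) (hT : 0 ≤ T) (hZ : EqOn Z Y (Icc 0 T)) :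
    IsSeparatedSolution γ K T δ L x Z where
  initial := (hZ ⟨le_rfl, hT⟩).trans hY.initial
  motion τ hτ := hZ hτ ▸ (hY.motion τ hτ).congr hZ (hZ hτ)
  separated τ hτ := hZ hτ ▸ hY.separated τ hτ

end NormedSpace

variable [InnerProductSpace ℝ E]

lemma truncation (hY : IsSeparatedSolution γ K T δ L x Y) (hK' : IsTruncation K δ L K') :
    IsSeparatedSolution γ K' T δ L x Y where
  initial := hY.initial
  motion τ hτ := by
    rw [hK'.vortexField_eq (hY.separated τ hτ)]
    exact hY.motion τ hτ
  separated := hY.separated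

variable [FiniteDimensional ℝ E]

lemma eqOn {δ' L' : ℝ} (hK : IsVortexKernel K) (hδ : 0 < δ) (hδ' : 0 < δ')
    (hY : IsSeparatedSolution γ K T δ L x Y) (hZ : IsSeparatedSolution γ K T δ' L' x Z) :
    EqOn Y Z (Icc 0 T) := by
  have hε : 0 < min δ δ' := lt_min hδ hδ'
  set R := max (max L L') (min δ δ' + 1)
  obtain ⟨K', hK'⟩ := hK.exists_isTruncation hε
    (show min δ δ' < R from (lt_add_one _).trans_le (le_max_right _ _))
  obtain ⟨Λ, hΛ⟩ := (isIncompressibleField_vortexField (γ := γ) hK'.contDiff hK'.hasCompactSupport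
    hK'.trace_fderiv Finset.univ).lipschitz
  have hY' := (hY.mono le_rfl (min_le_left δ δ')
    ((le_max_left L L').trans (le_max_left _ (min δ δ' + 1)))).truncation hK'
  have hZ' := (hZ.mono le_rfl (min_le_right δ δ')
    ((le_max_right L L').trans (le_max_left _ (min δ δ' + 1)))).truncation hK'
  have hright : ∀ {W : ℝ → ι → E} {v : ι → E} {τ : ℝ}, τ ∈ Ico 0 T →
      HasDerivWithinAt W v (Icc 0 T) τ → HasDerivWithinAt W v (Ici τ) τ := fun hτ h =>
    h.mono_of_mem_nhdsWithin
      (mem_of_superset (Icc_mem_nhdsGE hτ.2) (Icc_subset_Icc_left hτ.1))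
  exact ODE_solution_unique (v := fun _ => vortexField γ K' Finset.univ) (fun _ => hΛ)
    (HasDerivWithinAt.continuousOn hY'.motion)
    (fun τ hτ => hright hτ (hY'.motion τ (Ico_subset_Icc_self hτ)))
    (HasDerivWithinAt.continuousOn hZ'.motion)
    (fun τ hτ => hright hτ (hZ'.motion τ (Ico_subset_Icc_self hτ)))
    (hY.initial.trans hZ.initial.symm)

lemma contDiffOn (hK : IsVortexKernel K) (hδ : 0 < δ) (hY : IsSeparatedSolution γ K T δ L x Y) :
    ContDiffOn ℝ ∞ Y (Icc 0 T) := by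
  obtain ⟨K', hK'⟩ := hK.exists_isTruncation hδ
    (show δ < max L (δ + 1) from (lt_add_one δ).trans_le (le_max_right _ _))
  exact ODE.contDiffOn_enat_Icc_of_hasDerivWithinAt (n := ⊤) (u := univ)
    (f := fun _ => vortexField γ K' Finset.univ)
    ((contDiff_vortexField hK'.contDiff _).comp contDiff_snd).contDiffOn
    ((hY.mono le_rfl le_rfl (le_max_left L (δ + 1))).truncation hK').motion (mapsTo_univ _ _)

end IsSeparatedSolution

lemma exists_forall_eqOn_Icc_nat {α : Type*} {Y : ℕ → ℝ → α}
    (hY : ∀ m n, m ≤ n → EqOn (Y m) (Y n) (Icc 0 m)) : ∃ X, ∀ n, EqOn X (Y n) (Icc 0 n) :=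
  ⟨fun t => Y ⌈t⌉₊ t, fun n t ht => hY ⌈t⌉₊ n (Nat.ceil_le.2 ht.2) ⟨ht.1, Nat.le_ceil t⟩⟩

variable [InnerProductSpace ℝ E] [FiniteDimensional ℝ E]

lemma isGlobalCollisionlessSolution_of_forall_nat (hK : IsVortexKernel K) {X : ℝ → ι → E}
    (hX : ∀ n : ℕ, ∃ δ L, 0 < δ ∧ IsSeparatedSolution γ K n δ L x X) :
    IsGlobalCollisionlessSolution γ K x X := by
  choose δ L hδ hX using hX
  have hnhds : ∀ t : ℝ, 0 ≤ t → ∃ n : ℕ, t ∈ Icc (0 : ℝ) n ∧ Icc (0 : ℝ) n ∈ 𝓝[Ici 0] t := by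
    intro t ht
    obtain ⟨n, hn⟩ := exists_nat_gt t
    exact ⟨n, ⟨ht, hn.le⟩, by
      simpa only [Ici_inter_Iic] using inter_mem_nhdsWithin (Ici 0) (Iic_mem_nhds hn)⟩
  refine ⟨(hX 0).initial, fun t ht => ?_, fun t ht => ?_, fun t ht i j hij => ?_⟩ <;>
    obtain ⟨n, htn, hn⟩ := hnhds t ht
  · exact ((hX n).motion t htn).mono_of_mem_nhdsWithin hn
  · exact ((hX n).contDiffOn hK (hδ n) t htn).mono_of_mem_nhdsWithin hn
  · by_contra hne
    have := ((hX n).separated t htn i j hne).1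
    rw [hij, sub_self, norm_zero] at this
    exact this.not_gt (hδ n)

/-- By uniqueness, separated solutions on arbitrarily long time intervals patch together. -/
theorem exists_isGlobalCollisionlessSolution (hK : IsVortexKernel K)
    (h : ∀ n : ℕ, ∃ Y δ L, 0 < δ ∧ IsSeparatedSolution γ K n δ L x Y) :
    ∃ X, IsGlobalCollisionlessSolution γ K x X := by
  choose Y δ L hδ hY using h
  obtain ⟨X, hX⟩ := exists_forall_eqOn_Icc_nat fun m n hmn =>
    (hY m).eqOn hK (hδ m) (hδ n) ((hY n).mono (Nat.cast_le.2 hmn) le_rfl le_rfl)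
  exact ⟨X, isGlobalCollisionlessSolution_of_forall_nat hK fun n =>
    ⟨δ n, L n, hδ n, (hY n).congr n.cast_nonneg (hX n)⟩⟩

end SeparatedSolution

section AlmostEverywhere

lemma IsFlowOn.mem_ball_of_displacementBound {ι E : Type*} [Fintype ι] [DecidableEq ι]
    [NormedAddCommGroup E] [NormedSpace ℝ E] {γ : ι → ℝ} {K : E → E} {b R T : ℝ}
    {X : (ι → E) → ℝ → ι → E} (hγ : ∀ J : Finset ι, J.Nonempty → ∑ j ∈ J, γ j ≠ 0)
    (hK : K.Odd) (hb : 0 ≤ b) (hKb : ∀ u, 1 ≤ ‖u‖ → ‖K u‖ ≤ b)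
    (hX : IsFlowOn (vortexField γ K Finset.univ) (Metric.ball 0 R) T X) {x : ι → E}
    (hx : x ∈ Metric.ball 0 R) {t : ℝ} (ht : t ∈ Icc 0 T) :
    X x t ∈ Metric.ball 0 (R + displacementBound γ b T (Fintype.card ι) 0) := by
  have hT : 0 ≤ T := ht.1.trans ht.2
  have hmotion : IsClusterMotion γ K Finset.univ 0 (Icc 0 T) (X x) := fun j _ τ hτ =>
    ⟨_, hasDerivWithinAt_pi.1 (hX.motion x hx τ hτ) j, by simp⟩
  have hmove : dist (X x t) (X x 0) ≤ displacementBound γ b T (Fintype.card ι) 0 :=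
    (dist_pi_le_iff (displacementBound_nonneg hb hT _ le_rfl)).2 fun j =>
      hmotion.dist_le_displacementBound hγ hK hb hKb Finset.card_univ.le le_rfl (convex_Icc 0 T)
        (fun τ hτ τ' hτ' => (Real.dist_le_of_mem_Icc hτ hτ').trans_eq (sub_zero T))
        (Finset.mem_univ j) ht ⟨le_rfl, hT⟩
  rw [hX.initial x hx] at hmove
  rw [Metric.mem_ball] at hx ⊢
  linarith [dist_triangle (X x t) x 0]

variable {ι E : Type*} [Fintype ι] [DecidableEq ι] [NormedAddCommGroup E]
  [InnerProductSpace ℝ E] {γ : ι → ℝ} {K K' : E → E} {q : ℝ}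

lemma IsFlowOn.isSeparatedSolution {ε R R' T : ℝ} {X : (ι → E) → ℝ → ι → E}
    (hX : IsFlowOn (vortexField γ K' Finset.univ) (Metric.ball 0 R) T X)
    (hK' : IsTruncation K ε (2 * R' + ε) K') (hε : 0 < ε) {x : ι → E} (hx : x ∈ Metric.ball 0 R)
    (hXR : ∀ t ∈ Icc 0 T, X x t ∈ Metric.ball 0 R') (hq : 1 ≤ q)
    (henergy : ∀ t ∈ Icc 0 T, interactionEnergy q ε (X x t) < (2 * ε ^ 2) ^ ((1 - q) / 2)) :
    IsSeparatedSolution γ K T ε (2 * R' + ε) x (X x) := by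
  have hsep : ∀ τ ∈ Icc 0 T, ∀ i j, i ≠ j → ‖X x τ i - X x τ j‖ ∈ Icc ε (2 * R' + ε) := by
    intro τ hτ i j hij
    refine ⟨(lt_of_not_ge fun h => (henergy τ hτ).not_ge (le_interactionEnergy hq hε hij h)).le, ?_⟩
    have hR' := mem_ball_zero_iff.1 (hXR τ hτ)
    linarith [norm_sub_le (X x τ i) (X x τ j), norm_le_pi_norm (X x τ) i,
      norm_le_pi_norm (X x τ) j]
  refine ⟨hX.initial x hx, fun τ hτ => ?_, hsep⟩
  rw [← hK'.vortexField_eq (hsep τ hτ)]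
  exact hX.motion x hx τ hτ

variable [FiniteDimensional ℝ E] [MeasureSpace E] [BorelSpace E]
  [(volume : Measure E).IsAddHaarMeasure]

/-- The bad configurations are those along whose regularized flow the energy becomes large. Both
the distance travelled and the integral of the energy rate are bounded uniformly in `ε`. -/
lemma exists_forall_mul_volume_le (hγ : ∀ J : Finset ι, J.Nonempty → ∑ j ∈ J, γ j ≠ 0)
    (hK : IsVortexKernel K) (hq : 1 < q) (hqd : q < Module.finrank ℝ E) {C : ℝ≥0}
    (hKC : ∀ u, ‖K u‖ₑ ≤ C * collisionWeight q u) {R T : ℝ} (hR : 0 < R) (hT : 0 ≤ T) :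
    ∃ M ≠ ⊤, ∀ ε, 0 < ε → ENNReal.ofReal ((2 * ε ^ 2) ^ ((1 - q) / 2)) *
      volume {x ∈ Metric.ball (0 : ι → E) R |
        ¬ ∃ Y δ L, 0 < δ ∧ IsSeparatedSolution γ K T δ L x Y} ≤ M := by
  have hq0 : 0 < q := by linarith
  set R' := R + displacementBound γ (C * 2) T (Fintype.card ι) 0
  have hR' : 0 < R' :=
    add_pos_of_pos_of_nonneg hR (displacementBound_nonneg (by positivity) hT _ le_rfl)
  refine ⟨(∫⁻ x in Metric.ball (0 : ι → E) R, pairMajorant q x) + ENNReal.ofReal T *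
    (‖1 - q‖ₑ * (ENNReal.ofReal (absCirculation γ) * C) *
      ∫⁻ x in Metric.ball (0 : ι → E) R', tripleMajorant q x), ?_, fun ε hε => ?_⟩
  · have hpair := (setLIntegral_pairMajorant_lt_top (ι := ι) hq0 hqd hR).ne
    have htriple := (setLIntegral_tripleMajorant_lt_top (ι := ι) hq0 hqd hR').ne
    finiteness
  obtain ⟨K', hK'⟩ := hK.exists_isTruncation hε (show ε < 2 * R' + ε by linarith)
  have hK'C : ∀ u, ‖K' u‖ₑ ≤ C * collisionWeight q u := fun u =>
    (enorm_le_iff_norm_le.2 (hK'.norm_le u)).trans (hKC u)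
  have hK'b : ∀ u, 1 ≤ ‖u‖ → ‖K' u‖ ≤ C * 2 := fun u hu => by
    have hle : ‖K' u‖ₑ ≤ C * 2 :=
      (hK'C u).trans (mul_le_mul_right (collisionWeight_le_two hq0 hu) _)
    exact_mod_cast hle
  have hV := isIncompressibleField_vortexField (γ := γ) hK'.contDiff hK'.hasCompactSupport
    hK'.trace_fderiv Finset.univ
  obtain ⟨L, hL⟩ := hV.lipschitz
  obtain ⟨M, hM⟩ := hV.bounded
  obtain ⟨X, hX, hXc⟩ := exists_isFlowOn_closedBall hL hM hR.le hT
  replace hX := hX.mono Metric.ball_subset_closedBall le_rfl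
  have hXR : ∀ x ∈ Metric.ball 0 R, ∀ t ∈ Icc 0 T, X x t ∈ Metric.ball 0 R' := fun x hx t ht =>
    hX.mem_ball_of_displacementBound hγ hK'.odd (by positivity) hK'b hx ht
  refine (hV.mul_measure_le_of_forall_exists_le measurableSet_ball Metric.isOpen_ball hX
    (hXc.mono (by gcongr; exact Metric.ball_subset_closedBall)) hXR
    (contDiff_interactionEnergy q hε.ne') (fun x hx => hx.1) fun x hx => ?_).trans ?_
  · by_contra! henergy
    exact hx.2 ⟨X x, ε, _, hε, hX.isSeparatedSolution hK' hε hx.1 (hXR x hx.1) hq.le henergy⟩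
  · rw [← lintegral_const_mul' (‖1 - q‖ₑ * _) _ (by finiteness)]
    gcongr with x x
    · exact ofReal_interactionEnergy_le hq.le ε x
    · exact enorm_fderiv_interactionEnergy_le hq0 hε.ne' hK'.odd hK'.inner_self hK'C x

lemma eq_zero_of_forall_ofReal_rpow_mul_le {a M : ℝ≥0∞} (hM : M ≠ ⊤) {s : ℝ} (hs : s < 0)
    (h : ∀ ε : ℝ, 0 < ε → ENNReal.ofReal ((2 * ε ^ 2) ^ s) * a ≤ M) : a = 0 := by
  by_contra ha
  obtain ⟨n, hn⟩ := ENNReal.exists_nat_mul_gt ha hM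
  have hscale : Tendsto (fun ε : ℝ => 2 * ε ^ 2) (𝓝[>] 0) (𝓝[>] 0) :=
    tendsto_nhdsWithin_iff.2 ⟨tendsto_nhdsWithin_of_tendsto_nhds
      (Continuous.tendsto' (by fun_prop) _ _ (by norm_num)),
      eventually_mem_nhdsWithin.mono fun ε (hε : 0 < ε) => show 0 < 2 * ε ^ 2 by positivity⟩
  obtain ⟨ε, hnε, hε⟩ := ((((tendsto_rpow_neg_nhdsGT_zero hs).comp hscale).eventually_ge_atTop
    (n : ℝ)).and eventually_mem_nhdsWithin).exists
  refine hn.not_ge (le_trans ?_ (h ε hε))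
  gcongr
  rw [← ENNReal.ofReal_natCast]
  exact ENNReal.ofReal_le_ofReal hnε

theorem ae_exists_isSeparatedSolution (hγ : ∀ J : Finset ι, J.Nonempty → ∑ j ∈ J, γ j ≠ 0)
    (hK : IsVortexKernel K) (hq : 1 < q) (hqd : q < Module.finrank ℝ E) {C : ℝ≥0}
    (hKC : ∀ u, ‖K u‖ₑ ≤ C * collisionWeight q u) {T : ℝ} (hT : 0 ≤ T) :
    ∀ᵐ x : ι → E, ∃ Y δ L, 0 < δ ∧ IsSeparatedSolution γ K T δ L x Y := by
  have hball : ∀ n : ℕ, volume {x ∈ Metric.ball (0 : ι → E) (n + 1) |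
      ¬ ∃ Y δ L, 0 < δ ∧ IsSeparatedSolution γ K T δ L x Y} = 0 := fun n => by
    obtain ⟨M, hM, hle⟩ := exists_forall_mul_volume_le hγ hK hq hqd hKC
      (R := n + 1) (by positivity) hT
    exact eq_zero_of_forall_ofReal_rpow_mul_le hM (by linarith) hle
  filter_upwards [ae_all_iff.2 fun n => measure_eq_zero_iff_ae_notMem.1 (hball n)] with x hx
  obtain ⟨n, hn⟩ := exists_nat_gt ‖x‖
  by_contra hbad
  exact hx n ⟨mem_ball_zero_iff.2 (by linarith), hbad⟩

end AlmostEverywhere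

section PlaneKernel

/-- The rotation of the plane by a right angle; it turns the gradient into `perpGrad`. -/
def rot : Plane →L[ℝ] Plane :=
  LinearMap.toContinuousLinearMap
    { toFun := fun x => !₂[-x 1, x 0]
      map_add' := fun x y => by ext i; fin_cases i <;> simp [add_comm]
      map_smul' := fun r x => by ext i; fin_cases i <;> simp }

@[simp] lemma rot_apply_zero (x : Plane) : rot x 0 = -x 1 := rfl

@[simp] lemma rot_apply_one (x : Plane) : rot x 1 = x 0 := rfl

lemma inner_rot_self (x : Plane) : inner ℝ x (rot x) = 0 := by
  simp only [PiLp.inner_apply, Fin.sum_univ_two, rot_apply_zero, rot_apply_one,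
    Real.inner_apply]
  ring

lemma norm_rot (x : Plane) : ‖rot x‖ = ‖x‖ := by
  simp [EuclideanSpace.norm_eq, Fin.sum_univ_two, add_comm]

lemma trace_rot : LinearMap.trace ℝ Plane rot = 0 := by
  rw [LinearMap.trace_eq_sum_inner _ (EuclideanSpace.basisFun (Fin 2) ℝ)]
  exact Finset.sum_eq_zero fun i _ => inner_rot_self _

lemma odd_perpGrad_of_even {f : Plane → ℝ} (hf : f.Even) : (perpGrad f).Odd := by
  intro x
  have hderiv : fderiv ℝ f x = -fderiv ℝ f (-x) := by
    simpa only [neg_smul, one_smul, hf _] using fderiv_comp_smul (f := f) (x := x) (-1 : ℝ)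
  ext i
  fin_cases i <;> simp [perpGrad, hderiv]

lemma perpGrad_eq_smul_rot {f : Plane → ℝ} {x v : Plane} {a : ℝ}
    (hf : HasFDerivAt f (a • innerSL ℝ v) x) : perpGrad f x = a • rot v := by
  rw [perpGrad, hf.fderiv]
  ext i
  fin_cases i <;> simp [EuclideanSpace.inner_single_right]

lemma even_green (m c : ℝ) : (green m c).Even := fun x => by rw [green, green, norm_neg]

lemma perpGrad_green (m c : ℝ) {x : Plane} (hx : x ≠ 0) :
    perpGrad (green m c) x = (c * (m - 2) * (‖x‖ ^ 2) ^ ((m - 4) / 2)) • rot x := by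
  refine perpGrad_eq_smul_rot ?_
  have hG : green m c = fun y : Plane => c * (‖y‖ ^ 2) ^ ((m - 2) / 2) := by
    ext y
    rw [green, norm_sq_rpow_div_two]
  have hpow : HasDerivAt (fun s : ℝ => c * s ^ ((m - 2) / 2))
      (c * ((m - 2) / 2 * (‖x‖ ^ 2) ^ ((m - 2) / 2 - 1))) (‖x‖ ^ 2) :=
    (Real.hasDerivAt_rpow_const (.inl (by simpa using hx))).const_mul c
  have hcomp := hpow.comp_hasFDerivAt x (hasStrictFDerivAt_norm_sq x).hasFDerivAt
  rw [← Nat.cast_smul_eq_nsmul ℝ, smul_smul] at hcomp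
  rw [hG, show c * (m - 2) * (‖x‖ ^ 2) ^ ((m - 4) / 2) =
    c * ((m - 2) / 2 * (‖x‖ ^ 2) ^ ((m - 2) / 2 - 1)) * (2 : ℕ) by ring_nf]
  exact hcomp

lemma norm_perpGrad_green (m c : ℝ) {x : Plane} (hx : x ≠ 0) :
    ‖perpGrad (green m c) x‖ = |c * (m - 2)| * ‖x‖ ^ (m - 3) := by
  rw [perpGrad_green m c hx, norm_smul, norm_rot, norm_sq_rpow_div_two, norm_mul, mul_assoc,
    Real.norm_of_nonneg (by positivity : 0 ≤ ‖x‖ ^ (m - 4)),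
    ← Real.rpow_add_one (norm_ne_zero_iff.2 hx), Real.norm_eq_abs]
  ring_nf

lemma norm_perpGrad_green_le (m c : ℝ) {x : Plane} (hx : x ≠ 0) :
    ‖perpGrad (green m c) x‖ ≤ |c * (m - 2)| * (1 + ‖x‖ ^ (-(3 - m))) := by
  rw [norm_perpGrad_green m c hx, neg_sub]
  gcongr
  exact le_add_of_nonneg_left zero_le_one

lemma isVortexKernel_perpGrad_green (m c : ℝ) : IsVortexKernel (perpGrad (green m c)) where
  odd := odd_perpGrad_of_even (even_green m c)
  inner_self u := by
    rcases eq_or_ne u 0 with rfl | hu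
    · exact inner_zero_left _
    · rw [perpGrad_green m c hu, inner_smul_right, inner_rot_self, mul_zero]
  contDiffOn := by
    refine ContDiffOn.congr (fun u hu => ContDiffAt.contDiffWithinAt ?_) fun u =>
      perpGrad_green m c
    have hu' : ‖u‖ ^ 2 ≠ 0 := by simpa using hu
    exact (contDiffAt_const.mul ((contDiff_norm_sq ℝ).contDiffAt.rpow_const_of_ne hu')).smul
      rot.contDiff.contDiffAt
  trace_fderiv u hu := by
    have heq : perpGrad (green m c) =ᶠ[𝓝 u]
        fun v => (c * (m - 2) * (‖v‖ ^ 2) ^ ((m - 4) / 2)) • rot v :=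
      (eventually_ne_nhds hu).mono fun v => perpGrad_green m c
    have hprofile : DifferentiableAt ℝ (fun s : ℝ => c * (m - 2) * s ^ ((m - 4) / 2)) (‖u‖ ^ 2) :=
      ((Real.hasDerivAt_rpow_const (.inl (by simpa using hu))).const_mul _).differentiableAt
    rw [heq.fderiv_eq, trace_fderiv_comp_norm_sq_smul hprofile rot.differentiableAt
      (inner_rot_self u), rot.fderiv, trace_rot, mul_zero]

end PlaneKernel

lemma IsGlobalCollisionlessSolution.isGlobalSmoothSolution {N : ℕ} {G : Plane → ℝ}
    {γ : Fin N → ℝ} {x : Fin N → Plane} {X : ℝ → Fin N → Plane}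
    (hX : IsGlobalCollisionlessSolution γ (perpGrad G) x X) :
    IsGlobalSmoothSolution G γ x fun j t => X t j where
  initial := congrFun hX.initial
  noncollision t ht _ _ := (hX.injective t ht).ne
  smooth := contDiffOn_pi.1 hX.contDiffOn
  motion j t ht := hasDerivWithinAt_pi.1 (hX.motion t ht) j

end PointVortex

open PointVortex in
theorem theoremt_general {ι E : Type*} [Fintype ι] [DecidableEq ι] [NormedAddCommGroup E]
    [InnerProductSpace ℝ E] [FiniteDimensional ℝ E] [MeasureSpace E] [BorelSpace E]
    [(volume : Measure E).IsAddHaarMeasure] {γ : ι → ℝ}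
    (hγ : ∀ J : Finset ι, J.Nonempty → ∑ j ∈ J, γ j ≠ 0) {K : E → E} (hK : IsVortexKernel K)
    {q C : ℝ} (hq : 1 < q) (hqd : q < Module.finrank ℝ E)
    (hKq : ∀ u ≠ 0, ‖K u‖ ≤ C * (1 + ‖u‖ ^ (-q))) :
    ∀ᵐ x : ι → E, ∃ X, IsGlobalCollisionlessSolution γ K x X := by
  have hKC : ∀ u, ‖K u‖ₑ ≤ C.toNNReal * collisionWeight q u := by
    intro u
    rcases eq_or_ne u 0 with rfl | hu
    · have : IsAddTorsionFree E := .of_isTorsionFree ℝ E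
      simp [hK.odd.map_zero]
    · rw [collisionWeight_of_ne_zero q hu, ← ofReal_norm, ← ENNReal.ofReal,
        ← ENNReal.ofReal_mul' (by positivity)]
      exact ENNReal.ofReal_le_ofReal (hKq u hu)
  filter_upwards [ae_all_iff.2 fun n : ℕ =>
    ae_exists_isSeparatedSolution hγ hK hq hqd hKC n.cast_nonneg] with x hx
  exact exists_isGlobalCollisionlessSolution hK hx

end

theorem theoremt (N : ℕ) (m c : ℝ) (hm₁ : 1 < m) (hm₂ : m < 2) (hc : 0 < c)
    (γ : Fin N → ℝ)
    (hγ : ∀ J : Finset (Fin N), J.Nonempty → ∑ j ∈ J, γ j ≠ 0) :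
    ∀ᵐ x : Fin N → PointVortex.Plane ∂MeasureTheory.volume,
      ∃ X : Fin N → ℝ → PointVortex.Plane,
        PointVortex.IsGlobalSmoothSolution (PointVortex.green m c) γ x X := by
  have hrank : 3 - m < Module.finrank ℝ PointVortex.Plane := by
    rw [finrank_euclideanSpace_fin, Nat.cast_ofNat]
    linarith
  have hsol := theoremt_general hγ (PointVortex.isVortexKernel_perpGrad_green m c)
    (by linarith) hrank fun _ => PointVortex.norm_perpGrad_green_le m c
  exact hsol.mono fun x ⟨_, hX⟩ => ⟨_, hX.isGlobalSmoothSolution⟩
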